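/- Let $\mathbb{K}\in\{\mathbb{R},\mathbb{C}\}$, let $(X,\|\cdot\|)$ be a Banach space over $\mathbb{K}$ and let $\tau$ be a Hausdorff locally convex topology on $X$, coarser than the norm topology $\tau_{\|\cdot\|}$. **Definitions.** A *directed system of seminorms* generating a topology $\upsilon$ on $X$ is a non-empty set $\Gamma_\upsilon$ of seminorms that generates $\upsilon$ and such that any two members are dominated, up to a constant, by a third one; it is *norming* if $\|x\|=\sup_{p\in\Gamma_\upsilon}p(x)$ for all $x\in X$. The triple $(X,\|\cdot\|,\tau)$ is a *Saks space* if $\tau$ is generated by some norming directed system of seminorms. The *mixed topology* $\gamma=\gamma(\|\cdot\|,\tau)$ is the finest linear topology on $X$ that coincides with $\tau$ on $\|\cdot\|$-bounded sets and satisfies $\tau\subseteq\gamma\subseteq\tau_{\|\cdot\|}$. The Saks space is *complete* if $(X,\gamma)$ is complete. For a norming directed system $\Gamma_\tau$ generating $\tau$, the *submixed topology* $\gamma_s=\gamma_s(\Gamma_\tau)$ is the topology generated by the seminorms $x\mapsto\sup_{n\in\mathbb{N}}p_n(x)a_n$, where $(p_n)_{n\in\mathbb N}\subseteq\Gamma_\tau$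 and $(a_n)_{n\in\mathbb{N}}$ is a null sequence of non-negative real numbers. For a linear operator $A\colon D(A)\subseteq X\to X$, its *$\gamma$-closure* is its smallest $\gamma$-closed extension (if one exists), and $A$ is *$\Gamma_\gamma$-dissipative* if $p((\lambda-A)x)\ge\lambda p(x)$ for all $\lambda>0$, $x\in D(A)$, $p\in\Gamma_\gamma$. A semigroup $(T(t))_{t\ge0}$ of linear maps $X\to X$ (that is, $T(0)=\mathrm{id}$ and $T(t+s)=T(t)T(s)$) is *$\gamma$-strongly continuous* if $t\mapsto T(t)x\in(X,\gamma)$ is continuous on $[0,\infty)$ for every $x\in X$; it is *$\gamma$-equicontinuous* if for every $p\in\Gamma_\gamma$ there are $\widetilde p\in\Gamma_\gamma$ and $C\ge0$ with $p(T(t)x)\le C\widetilde p(x)$ for all $t\ge0$, $x\in X$; it is a *contraction semigroup* if $\|T(t)x\|\le\|x\|$ for all $t\ge 0$, $x\in X$; and it is *$(\|\cdot\|,\tau)$-equitight* if, for a directed system $\Gamma_\tau$ generating $\tau$ (equivalently, for every such system), for every $\varepsilon>0$ and $p\in\Gamma_\tau$ there are $\widetilde p\in\Gamma_\tau$ and $C\ge0$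 with $p(T(t)x)\le C\widetilde p(x)+\varepsilon\|x\|$ for all $t\ge0$, $x\in X$. An operator $B$ *generates* $(T(t))_{t\ge0}$ (with respect to $\gamma$) if $D(B)$ is the set of all $x\in X$ for which $\gamma\text{-}\lim_{t\to0+}\frac{T(t)x-x}{t}$ exists, and $Bx$ is this limit. **Theorem.** Let $(X,\|\cdot\|,\tau)$ be a complete Saks space, let $\Gamma_\gamma$ be a directed system of seminorms generating $\gamma$, and let $A\colon D(A)\subseteq X\to X$ be a linear operator that is $\Gamma_\gamma$-dissipative and whose domain $D(A)$ is $\gamma$-dense in $X$. Assume that $\mathrm{Ran}(\lambda-A)$ is $\gamma$-dense in $X$ for some $\lambda>0$. Then the following assertions hold: (a) The $\gamma$-closure $\overline{A}$ of $A$ exists and generates a $\gamma$-strongly continuous, $\gamma$-equicontinuous semigroup $(T(t))_{t\ge0}$ on $X$. (b) If $\Gamma_\gamma$ is norming, then $(T(t))_{t\ge0}$ is a contraction semigroup. (c) If $\Gamma_\gamma$ is norming and $\gamma=\gamma_s(\Gamma_\tau)$ for some norming directed system $\Gamma_\tau$ generating $\tau$, then $(T(t))_{t\ge0}$ is $(\|\cdot\|,\tau)$-equitight.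 -/

import Mathlib

open Filter Topology
open scoped NNReal

namespace Saks

/-! ### Systems of seminorms and the topologies they generate -/

section Seminorms

/-- The locally convex topology generated by a set `Γ` of seminorms. -/
@[reducible] def generatedTopology {𝕜 X : Type*} [RCLike 𝕜] [AddCommGroup X] [Module 𝕜 X]
    (Γ : Set (Seminorm 𝕜 X)) : TopologicalSpace X :=
  (SeminormFamily.moduleFilterBasis (fun p : Γ => (p : Seminorm 𝕜 X))).topology

/-- `Γ` is a directed system of seminorms that generates the topology `t` (its members are then
automatically `t`-continuous). Directedness is required up to constants only, which contains the
case of a system directed for the pointwise order. -/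
structure IsDirectedSystem {𝕜 X : Type*} [RCLike 𝕜] [AddCommGroup X] [Module 𝕜 X]
    (t : TopologicalSpace X) (Γ : Set (Seminorm 𝕜 X)) : Prop where
  nonempty : Γ.Nonempty
  directed : ∀ p ∈ Γ, ∀ q ∈ Γ, ∃ r ∈ Γ, ∃ C : ℝ, 0 ≤ C ∧ ∀ x, max (p x) (q x) ≤ C * r x
  generates : t = generatedTopology Γ

/-- `Γ` is norming: `‖x‖ = sup {p x | p ∈ Γ}` for all `x`. -/
def IsNorming {𝕜 X : Type*} [RCLike 𝕜] [NormedAddCommGroup X] [NormedSpace 𝕜 X]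
    (Γ : Set (Seminorm 𝕜 X)) : Prop :=
  ∀ x : X, IsLUB ((fun p : Seminorm 𝕜 X => p x) '' Γ) ‖x‖

end Seminorms

/-! ### The mixed topology, the submixed topology and Saks spaces -/

section Mixed

/-- The topology `τ_‖·‖` induced by the norm. -/
@[reducible] def normTopology (X : Type*) [NormedAddCommGroup X] : TopologicalSpace X :=
  UniformSpace.toTopologicalSpace

/-- The linear topologies `t` on `X` with `τ ⊆ t ⊆ τ_‖·‖` that coincide with `τ` on norm-bounded
sets. (In Mathlib `t₁ ≤ t₂` means that `t₁` is finer than `t₂`.) -/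
def mixedCandidates (𝕜 : Type*) {X : Type*} [RCLike 𝕜] [NormedAddCommGroup X] [NormedSpace 𝕜 X]
    (τ : TopologicalSpace X) : Set (TopologicalSpace X) :=
  {t | @IsTopologicalAddGroup X t _ ∧ @ContinuousSMul 𝕜 X _ _ t ∧
    (∀ B : Set X, Bornology.IsBounded B →
      t.induced (Subtype.val : B → X) = τ.induced (Subtype.val : B → X)) ∧
    t ≤ τ ∧ normTopology X ≤ t}

/-- The mixed topology `γ(‖·‖, τ)`: the finest of the topologies in `mixedCandidates`
(see `isLeast_mixedTopology`). -/
@[reducible] def mixedTopology (𝕜 : Type*) {X : Type*} [RCLike 𝕜] [NormedAddCommGroup X] [NormedSpace 𝕜 X]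
    (τ : TopologicalSpace X) : TopologicalSpace X :=
  sInf (mixedCandidates 𝕜 τ)

/-- The mixed topology is a vector-space topology; needed to speak of its uniform structure. -/
theorem mixedTopology_isTopologicalAddGroup (𝕜 : Type*) {X : Type*} [RCLike 𝕜]
    [NormedAddCommGroup X] [NormedSpace 𝕜 X] (τ : TopologicalSpace X) :
    @IsTopologicalAddGroup X (mixedTopology 𝕜 τ) _ :=
  topologicalAddGroup_sInf fun _ ht => ht.1

/-- The mixed topology is the finest topology in `mixedCandidates` whenever `τ` is a linear
topology coarser than the norm topology. -/
theorem isLeast_mixedTopology (𝕜 : Type*) {X : Type*} [RCLike 𝕜]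
    [NormedAddCommGroup X] [NormedSpace 𝕜 X] (τ : TopologicalSpace X)
    (h₁ : @IsTopologicalAddGroup X τ _) (h₂ : @ContinuousSMul 𝕜 X _ _ τ)
    (h₃ : normTopology X ≤ τ) :
    IsLeast (mixedCandidates 𝕜 τ) (mixedTopology 𝕜 τ) := by
  have hτ : τ ∈ mixedCandidates 𝕜 τ := ⟨h₁, h₂, fun _ _ => rfl, le_rfl, h₃⟩
  refine ⟨⟨mixedTopology_isTopologicalAddGroup 𝕜 τ, continuousSMul_sInf fun _ ht => ht.2.1,
    fun B hB => ?_, sInf_le hτ, le_sInf fun _ ht => ht.2.2.2.2⟩, fun _ ht => sInf_le ht⟩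
  apply le_antisymm
  · exact induced_mono (sInf_le hτ)
  · unfold mixedTopology
    rw [sInf_eq_iInf', induced_iInf]
    exact le_iInf fun t => (t.2.2.2.1 B hB).ge

/-- `(X, ‖·‖, τ)` is a Saks space: `τ` is a Hausdorff locally convex topology on `X`, coarser than
the norm topology and generated by a norming directed system of seminorms. (Being generated by
seminorms, `τ` is a locally convex vector-space topology.) Completeness of `(X, ‖·‖)` is a separate
type class assumption. -/
structure IsSaksSpace (𝕜 : Type*) {X : Type*} [RCLike 𝕜] [NormedAddCommGroup X]
    [NormedSpace 𝕜 X] (τ : TopologicalSpace X) : Prop where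
  t2 : @T2Space X τ
  coarser : normTopology X ≤ τ
  exists_norming : ∃ Γ : Set (Seminorm 𝕜 X), IsDirectedSystem τ Γ ∧ IsNorming Γ

/-- A complete Saks space: a Saks space for which `X` with the mixed topology is a complete
topological vector space (every Cauchy filter converges). -/
structure IsCompleteSaksSpace (𝕜 : Type*) {X : Type*} [RCLike 𝕜] [NormedAddCommGroup X]
    [NormedSpace 𝕜 X] (τ : TopologicalSpace X) : Prop extends IsSaksSpace 𝕜 τ where
  complete : @CompleteSpace X (@IsTopologicalAddGroup.rightUniformSpace X _ (mixedTopology 𝕜 τ)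
    (mixedTopology_isTopologicalAddGroup 𝕜 τ))

/-- The seminorms `x ↦ sup_n p_n(x) a_n` with `p_n ∈ Γ` and `(a_n)` a nonnegative real
null sequence. -/
def submixedSeminorms {𝕜 X : Type*} [RCLike 𝕜] [AddCommGroup X] [Module 𝕜 X]
    (Γ : Set (Seminorm 𝕜 X)) : Set (Seminorm 𝕜 X) :=
  {q | ∃ (p : ℕ → Seminorm 𝕜 X) (a : ℕ → ℝ), (∀ n, p n ∈ Γ) ∧ (∀ n, 0 ≤ a n) ∧
    Tendsto a atTop (𝓝 0) ∧ ∀ x, IsLUB (Set.range fun n => p n x * a n) (q x)}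

/-- The submixed topology `γ_s` formed with the norming system `Γ` of `τ`. -/
@[reducible] def submixedTopology {𝕜 X : Type*} [RCLike 𝕜] [AddCommGroup X] [Module 𝕜 X]
    (Γ : Set (Seminorm 𝕜 X)) : TopologicalSpace X :=
  generatedTopology (submixedSeminorms Γ)

end Mixed

/-! ### Unbounded operators -/

section Operators

/-- `B` is the `t`-closure of the operator `A`: the smallest `t`-closed extension of `A`
(`≤` is extension of operators; `t`-closed means that the graph is closed for the product of `t`
with itself). In particular `A` is then `t`-closable. -/
def IsClosureOf {𝕜 X : Type*} [RCLike 𝕜] [AddCommGroup X] [Module 𝕜 X]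
    (t : TopologicalSpace X) (A B : X →ₗ.[𝕜] X) : Prop :=
  IsLeast {C : X →ₗ.[𝕜] X | A ≤ C ∧
    @IsClosed (X × X) (@instTopologicalSpaceProd X X t t) (C.graph : Set (X × X))} B

/-- The range of `r - A`. -/
def rangeSub {𝕜 X : Type*} [RCLike 𝕜] [AddCommGroup X] [Module 𝕜 X]
    (A : X →ₗ.[𝕜] X) (r : ℝ) : Set X :=
  Set.range fun x : A.domain => (r : 𝕜) • (x : X) - A x

/-- `A` is `Γ`-dissipative. -/
def IsDissipative {𝕜 X : Type*} [RCLike 𝕜] [AddCommGroup X] [Module 𝕜 X]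
    (Γ : Set (Seminorm 𝕜 X)) (A : X →ₗ.[𝕜] X) : Prop :=
  ∀ r : ℝ, 0 < r → ∀ x : A.domain, ∀ p ∈ Γ, r * p (x : X) ≤ p ((r : 𝕜) • (x : X) - A x)

end Operators

/-! ### Semigroups of linear operators -/

section Semigroups

/-- `(T(s))_{s ≥ 0}` is a semigroup of linear maps. -/
structure IsSemigroup {𝕜 X : Type*} [RCLike 𝕜] [AddCommGroup X] [Module 𝕜 X]
    (T : ℝ≥0 → X →ₗ[𝕜] X) : Prop where
  zero : T 0 = LinearMap.id
  add : ∀ s u : ℝ≥0, T (s + u) = T s ∘ₗ T u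

/-- All orbits `s ↦ T(s) x` are continuous from `[0, ∞)` to `(X, t)`. -/
def IsStronglyContinuous {𝕜 X : Type*} [RCLike 𝕜] [AddCommGroup X] [Module 𝕜 X]
    (t : TopologicalSpace X) (T : ℝ≥0 → X →ₗ[𝕜] X) : Prop :=
  ∀ x : X, @Continuous ℝ≥0 X _ t fun s => T s x

/-- Equicontinuity of the family `T`, in terms of a directed system `Γ` generating the topology. -/
def IsEquicontinuous {𝕜 X : Type*} [RCLike 𝕜] [AddCommGroup X] [Module 𝕜 X]
    (Γ : Set (Seminorm 𝕜 X)) (T : ℝ≥0 → X →ₗ[𝕜] X) : Prop :=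
  ∀ p ∈ Γ, ∃ q ∈ Γ, ∃ C : ℝ, 0 ≤ C ∧ ∀ (s : ℝ≥0) (x : X), p (T s x) ≤ C * q x

/-- `(‖·‖, τ)`-equitightness of the family `T`, in terms of a directed system `Γ`
generating `τ`. -/
def IsEquitight {𝕜 X : Type*} [RCLike 𝕜] [NormedAddCommGroup X] [NormedSpace 𝕜 X]
    (Γ : Set (Seminorm 𝕜 X)) (T : ℝ≥0 → X →ₗ[𝕜] X) : Prop :=
  ∀ ε : ℝ, 0 < ε → ∀ p ∈ Γ, ∃ q ∈ Γ, ∃ C : ℝ, 0 ≤ C ∧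
    ∀ (s : ℝ≥0) (x : X), p (T s x) ≤ C * q x + ε * ‖x‖

/-- `A` is the generator of `T` with respect to the (Hausdorff) topology `t`: its domain consists
of all `x` for which `(T(s) x - x) / s` has a `t`-limit as `s → 0+`, and `A x` is this limit. -/
def IsGenerator {𝕜 X : Type*} [RCLike 𝕜] [AddCommGroup X] [Module 𝕜 X]
    (t : TopologicalSpace X) (T : ℝ≥0 → X →ₗ[𝕜] X) (A : X →ₗ.[𝕜] X) : Prop :=
  ∀ x y : X, (x, y) ∈ A.graph ↔
    Tendsto (fun s : ℝ≥0 => (((s : ℝ) : 𝕜))⁻¹ • (T s x - x)) (𝓝[>] 0) (@nhds X t y)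

/-- `T` consists of contractions on `(X, ‖·‖)`. -/
def IsContractive {𝕜 X : Type*} [RCLike 𝕜] [NormedAddCommGroup X] [NormedSpace 𝕜 X]
    (T : ℝ≥0 → X →ₗ[𝕜] X) : Prop :=
  ∀ (s : ℝ≥0) (x : X), ‖T s x‖ ≤ ‖x‖

end Semigroups

end Saks

/-! Dissipativity is required for each seminorm of `Γ` with constant one, so the resolvents satisfy
`p (R z) ≤ r⁻¹ * p z` with a constant that does not depend on `p`. The linear maps with such a
uniform bound form an algebra `boundedEnd Γ`, which is a Banach algebra because the mixed topology
is Hausdorff and complete. Neumann series and exponentials are therefore available, and the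
Hille–Yosida argument runs there, with strong convergence tested by each `p ∈ Γ` separately
(`exists_yosida`, `exists_semigroup`). The limit satisfies `p (T s x) ≤ p x`.

To reach that setting, the closure of the graph of `A` is shown to be a graph
(`eq_zero_of_dissipative`) on which `r - A` is onto (`surjective_of_dense_range`). Maximality then
makes this closure the whole generator (`mem_of_tendsto`).

The bound `p (T s x) ≤ p x` is equicontinuity, and its supremum over a norming `Γ` is contractivity.
For equitightness, a continuous seminorm is dominated by finitely many suprema of `p_n(x) a_n`.
Since `a_n → 0` and `p_n ≤ ‖·‖`, the tail of each costs only `ε * ‖x‖`, and the remaining finitely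
many terms are `τ`-continuous. -/

namespace Saks

/-! ### Exponentials in a real Banach algebra. -/

section BanachAlgebra

variable {B : Type*} [NormedRing B] [NormedAlgebra ℝ B] [CompleteSpace B]

open NormedSpace in
-- The unit is only assumed to have norm at most one, since its norm is zero when the algebra is
-- trivial.
theorem norm_exp_le_exp_norm (h1 : ‖(1 : B)‖ ≤ 1) (x : B) : ‖exp x‖ ≤ Real.exp ‖x‖ := by
  have hn : ∀ n : ℕ, ‖x ^ n‖ ≤ ‖x‖ ^ n := by
    intro n
    rcases Nat.eq_zero_or_pos n with rfl | h
    · simpa using h1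
    · exact norm_pow_le' x h
  have hs := NormedSpace.exp_series_hasSum_exp' (𝕂 := ℝ) x
  have hs2 := NormedSpace.exp_series_hasSum_exp' (𝕂 := ℝ) ‖x‖
  rw [← Real.exp_eq_exp_ℝ] at hs2
  rw [← hs.tsum_eq]
  refine tsum_of_norm_bounded hs2 fun n => ?_
  rw [norm_smul, smul_eq_mul, Real.norm_of_nonneg (by positivity)]
  exact mul_le_mul_of_nonneg_left (hn n) (by positivity)

open NormedSpace in
-- The scalar part contributes the factor `exp (-(s * c))`, which cancels the growth `exp (s * c)`
-- of the exponential of `(s * c) • S`.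
theorem norm_exp_smul_sub_one_le (h1 : ‖(1 : B)‖ ≤ 1) {S : B} (hS : ‖S‖ ≤ 1) {c s : ℝ} (hc : 0 ≤ c)
    (hs : 0 ≤ s) : ‖exp (s • c • (S - 1))‖ ≤ 1 := by
  have he : s • c • (S - 1) = (s * c) • S + algebraMap ℝ B (-(s * c)) := by
    rw [Algebra.algebraMap_eq_smul_one, smul_smul, smul_sub, neg_smul, sub_eq_add_neg]
  have hm : exp (algebraMap ℝ B (-(s * c))) = algebraMap ℝ B (Real.exp (-(s * c))) := by
    rw [Real.exp_eq_exp_ℝ, algebraMap_exp_comm]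
  let : NormedAlgebra ℚ B := NormedAlgebra.restrictScalars ℚ ℝ B
  rw [he, exp_add_of_commute (Algebra.commutes' _ _).symm, hm, ← Algebra.commutes,
    ← Algebra.smul_def, norm_smul, Real.norm_of_nonneg (Real.exp_pos _).le]
  have h2 : ‖(s * c) • S‖ ≤ s * c := by
    rw [norm_smul, Real.norm_of_nonneg (by positivity)]
    exact mul_le_of_le_one_right (by positivity) hS
  calc _ ≤ Real.exp (-(s * c)) * Real.exp (s * c) := by
        gcongr
        exact (norm_exp_le_exp_norm h1 _).trans (Real.exp_le_exp.2 h2)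
    _ = 1 := by rw [← Real.exp_add]; simp

theorem continuous_exp_smul (K : B) : Continuous fun s : ℝ => NormedSpace.exp (s • K) :=
  letI : NormedAlgebra ℚ B := NormedAlgebra.restrictScalars ℚ ℝ B
  NormedSpace.exp_continuous.comp (continuous_id.smul continuous_const)

open NormedSpace in
-- Duhamel's formula, with `D` the integral of `exp (s • K) * exp ((t - s) • L)`. A factorization is
-- kept because `K - L` is small only on particular vectors, not in norm.
theorem exp_smul_sub_exp_smul_eq_mul {K L : B} (hKL : Commute K L)
    (hK : ∀ s : ℝ, 0 ≤ s → ‖exp (s • K)‖ ≤ 1) (hL : ∀ s : ℝ, 0 ≤ s → ‖exp (s • L)‖ ≤ 1)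
    {t : ℝ} (ht : 0 ≤ t) :
    ∃ D : B, exp (t • K) - exp (t • L) = D * (K - L) ∧ ‖D‖ ≤ t := by
  set f : ℝ → B := fun s => exp (s • K) * exp ((t - s) • L)
  have hf : Continuous f := (continuous_exp_smul K).mul
    ((continuous_exp_smul L).comp (continuous_const.sub continuous_id))
  have hd : ∀ s, HasDerivAt f (f s * (K - L)) s := by
    intro s
    have h1 := hasDerivAt_exp_smul_const K s
    have h2 : HasDerivAt (fun s : ℝ => exp ((t - s) • L)) ((-1 : ℝ) • (exp ((t - s) • L) * L)) s :=
      (hasDerivAt_exp_smul_const L (t - s)).scomp s ((hasDerivAt_id s).const_sub t)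
    convert! h1.mul h2 using 1
    have hc : Commute K (exp ((t - s) • L)) := (hKL.smul_right _).exp_right
    simp only [f, neg_smul, one_smul, mul_neg]
    rw [mul_assoc (exp (s • K)) K, hc.eq]
    noncomm_ring
  refine ⟨∫ s in (0:ℝ)..t, f s, ?_, ?_⟩
  · have h3 := intervalIntegral.integral_eq_sub_of_hasDerivAt (a := 0) (b := t)
      (fun s _ => hd s) ((hf.mul continuous_const).intervalIntegrable _ _)
    have h4 := ((ContinuousLinearMap.mul ℝ B).flip (K - L)).intervalIntegral_comp_comm
      (μ := MeasureTheory.volume)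
      (hf.intervalIntegrable 0 t)
    simp only [ContinuousLinearMap.flip_apply, ContinuousLinearMap.mul_apply'] at h4
    rw [← h4, h3]
    simp [f]
  · have := intervalIntegral.norm_integral_le_of_norm_le_const (a := 0) (b := t) (f := f) (C := 1)
      (fun s hs => by
        rw [Set.uIoc_of_le ht] at hs
        exact (norm_mul_le _ _).trans
          (mul_le_one₀ (hK s hs.1.le) (norm_nonneg _) (hL _ (sub_nonneg.2 hs.2))))
    simpa [abs_of_nonneg ht] using this

open NormedSpace in
-- Taylor's formula to first and second order with integral remainders `D` and `E`. The bound on `E`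
-- is not sharp, but only its quadratic order matters.
theorem exp_smul_taylor {K : B} (hK : ∀ s : ℝ, 0 ≤ s → ‖exp (s • K)‖ ≤ 1)
    {t : ℝ} (ht : 0 ≤ t) :
    ∃ D E : B, exp (t • K) - 1 = D * K ∧ D - t • 1 = E * K ∧ ‖D‖ ≤ t ∧ ‖E‖ ≤ t ^ 2 := by
  set f : ℝ → B := fun s => exp (s • K)
  set g : ℝ → B := fun s => (t - s) • exp (s • K)
  have hf : Continuous f := continuous_exp_smul K
  have hg : Continuous g := (continuous_const.sub continuous_id).smul hf
  have hd : ∀ s, HasDerivAt f (f s * K) s := fun s => hasDerivAt_exp_smul_const K s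
  have hd' : ∀ s, HasDerivAt g (g s * K - f s) s := by
    intro s
    have h : HasDerivAt (fun s : ℝ => t - s) (-1) s := (hasDerivAt_id s).const_sub t
    convert! h.smul (hd s) using 1
    simp [g, f, sub_eq_add_neg]
  have hm : ∀ {h : ℝ → B}, Continuous h → ∫ s in (0:ℝ)..t, h s * K = (∫ s in (0:ℝ)..t, h s) * K := by
    intro h hh
    have h4 := ((ContinuousLinearMap.mul ℝ B).flip K).intervalIntegral_comp_comm
      (μ := MeasureTheory.volume)
      (hh.intervalIntegrable 0 t)
    simpa only [ContinuousLinearMap.flip_apply, ContinuousLinearMap.mul_apply'] using h4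
  refine ⟨∫ s in (0:ℝ)..t, f s, ∫ s in (0:ℝ)..t, g s, ?_, ?_, ?_, ?_⟩
  · rw [← hm hf, intervalIntegral.integral_eq_sub_of_hasDerivAt (f := f) (fun s _ => hd s)
      ((hf.mul continuous_const).intervalIntegrable 0 t)]
    simp [f]
  · have h3 := intervalIntegral.integral_eq_sub_of_hasDerivAt (a := 0) (b := t) (fun s _ => hd' s)
      (((hg.mul continuous_const).sub hf).intervalIntegrable _ _)
    rw [intervalIntegral.integral_sub (f := fun s => g s * K)
      ((hg.mul continuous_const).intervalIntegrable _ _) (hf.intervalIntegrable _ _), hm hg] at h3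
    have h5 : g t - g 0 = -(t • (1 : B)) := by simp [g]
    rw [h5] at h3
    rw [sub_eq_iff_eq_add] at h3 ⊢
    rw [h3]; abel
  · have := intervalIntegral.norm_integral_le_of_norm_le_const (a := 0) (b := t) (f := f) (C := 1)
      (fun s hs => by
        rw [Set.uIoc_of_le ht] at hs
        exact hK s hs.1.le)
    simpa [abs_of_nonneg ht] using this
  · have := intervalIntegral.norm_integral_le_of_norm_le_const (a := 0) (b := t) (f := g) (C := t)
      (fun s hs => by
        rw [Set.uIoc_of_le ht] at hs
        simp only [g]
        rw [norm_smul, Real.norm_of_nonneg (sub_nonneg.2 hs.2)]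
        nlinarith [hK s hs.1.le, norm_nonneg (exp (s • K)), hs.1, hs.2])
    simpa [abs_of_nonneg ht, sq] using this

end BanachAlgebra

/-! ### The Banach algebra of uniformly bounded operators. -/

section BoundedEnd

variable {𝕜 X : Type*} [RCLike 𝕜] [AddCommGroup X] [Module 𝕜 X]

/-- `Γ` separates the points of `X`. -/
class IsSeparating (Γ : Set (Seminorm 𝕜 X)) : Prop where
  eq_zero : ∀ x : X, (∀ p ∈ Γ, p x = 0) → x = 0

/-- Every sequence that is Cauchy for all seminorms in `Γ` converges for all of them. -/
class IsSeqComplete (Γ : Set (Seminorm 𝕜 X)) : Prop where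
  exists_lim : ∀ u : ℕ → X, (∀ p ∈ Γ, ∀ ε : ℝ, 0 < ε → ∃ N, ∀ m ≥ N, ∀ n ≥ N, p (u m - u n) < ε) →
    ∃ x, ∀ p ∈ Γ, Tendsto (fun n => p (u n - x)) atTop (𝓝 0)

variable [Module ℝ X] [IsScalarTower ℝ 𝕜 X]

theorem seminorm_real_smul (p : Seminorm 𝕜 X) (r : ℝ) (x : X) : p (r • x) = |r| * p x := by
  rw [← algebraMap_smul 𝕜 r x, map_smul_eq_mul, norm_algebraMap', Real.norm_eq_abs]

/-- The algebra of the linear maps that are bounded with a uniform constant for all seminorms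
in `Γ`. -/
def boundedEnd (Γ : Set (Seminorm 𝕜 X)) : Subalgebra ℝ (Module.End 𝕜 X) where
  carrier := {T | ∃ C : ℝ, 0 ≤ C ∧ ∀ p ∈ Γ, ∀ x, p (T x) ≤ C * p x}
  mul_mem' := by
    rintro S T ⟨C, hC, hS⟩ ⟨D, hD, hT⟩
    refine ⟨C * D, by positivity, fun p hp x => ?_⟩
    calc p (S (T x)) ≤ C * p (T x) := hS p hp _
      _ ≤ C * (D * p x) := by gcongr; exact hT p hp x
      _ = C * D * p x := by ring
  add_mem' := by
    rintro S T ⟨C, hC, hS⟩ ⟨D, hD, hT⟩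
    refine ⟨C + D, by positivity, fun p hp x => ?_⟩
    calc p (S x + T x) ≤ p (S x) + p (T x) := map_add_le_add _ _ _
      _ ≤ C * p x + D * p x := add_le_add (hS p hp x) (hT p hp x)
      _ = (C + D) * p x := by ring
  algebraMap_mem' r := by
    refine ⟨|r|, abs_nonneg r, fun p _ x => ?_⟩
    rw [Module.algebraMap_end_apply, seminorm_real_smul]

variable {Γ : Set (Seminorm 𝕜 X)}

/-- The admissible constants in the definition of `boundedEnd`. -/
def bounds (T : boundedEnd Γ) : Set ℝ :=
  {C | 0 ≤ C ∧ ∀ p ∈ Γ, ∀ x, p ((T : Module.End 𝕜 X) x) ≤ C * p x}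

theorem bounds_nonempty (T : boundedEnd Γ) : (bounds T).Nonempty := T.2

/-- The admissible constants form a closed set bounded below, so the infimum is itself admissible.
-/
theorem sInf_bounds_mem (T : boundedEnd Γ) : sInf (bounds T) ∈ bounds T := by
  have hc : IsClosed (bounds T) := by
    have : bounds T = Set.Ici 0 ∩ ⋂ p ∈ Γ, ⋂ x, {C | p ((T : Module.End 𝕜 X) x) ≤ C * p x} := by
      ext C; simp [bounds]
    rw [this]
    refine isClosed_Ici.inter (isClosed_biInter fun p _ => isClosed_iInter fun x => ?_)
    exact isClosed_le continuous_const (continuous_id.mul continuous_const)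
  exact hc.csInf_mem (bounds_nonempty T) ⟨0, fun C hC => hC.1⟩

theorem sInf_bounds_le {T : boundedEnd Γ} {C : ℝ} (hC : 0 ≤ C)
    (h : ∀ p ∈ Γ, ∀ x, p ((T : Module.End 𝕜 X) x) ≤ C * p x) : sInf (bounds T) ≤ C :=
  csInf_le ⟨0, fun _ hC => hC.1⟩ ⟨hC, h⟩

/-- The operator norm on `boundedEnd Γ`. -/
noncomputable def boundedEndNorm (Γ : Set (Seminorm 𝕜 X)) [IsSeparating Γ] : RingNorm (boundedEnd Γ) where
  toFun T := sInf (bounds T)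
  map_zero' := le_antisymm (sInf_bounds_le le_rfl (by simp)) (sInf_bounds_mem _).1
  add_le' S T := by
    refine sInf_bounds_le (add_nonneg (sInf_bounds_mem S).1 (sInf_bounds_mem T).1) fun p hp x => ?_
    calc p ((S : Module.End 𝕜 X) x + (T : Module.End 𝕜 X) x)
        ≤ p ((S : Module.End 𝕜 X) x) + p ((T : Module.End 𝕜 X) x) := map_add_le_add _ _ _
      _ ≤ sInf (bounds S) * p x + sInf (bounds T) * p x :=
          add_le_add ((sInf_bounds_mem S).2 p hp x) ((sInf_bounds_mem T).2 p hp x)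
      _ = _ := by ring
  neg' T := by
    congr 1
    ext C
    simp [bounds]
  mul_le' S T := by
    refine sInf_bounds_le (mul_nonneg (sInf_bounds_mem S).1 (sInf_bounds_mem T).1) fun p hp x => ?_
    calc p ((S : Module.End 𝕜 X) ((T : Module.End 𝕜 X) x))
        ≤ sInf (bounds S) * p ((T : Module.End 𝕜 X) x) := (sInf_bounds_mem S).2 p hp _
      _ ≤ sInf (bounds S) * (sInf (bounds T) * p x) :=
          mul_le_mul_of_nonneg_left ((sInf_bounds_mem T).2 p hp x) (sInf_bounds_mem S).1
      _ = _ := by ring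
  eq_zero_of_map_eq_zero' T hT := by
    ext x
    refine IsSeparating.eq_zero (Γ := Γ) _ fun p hp => ?_
    have := (sInf_bounds_mem T).2 p hp x
    have hT' : sInf (bounds T) = 0 := hT
    rw [hT', zero_mul] at this
    exact le_antisymm this (apply_nonneg _ _)

variable [IsSeparating Γ]

noncomputable instance : NormedRing (boundedEnd Γ) := (boundedEndNorm Γ).toNormedRing

theorem seminorm_apply_le (T : boundedEnd Γ) {p : Seminorm 𝕜 X} (hp : p ∈ Γ) (x : X) :
    p ((T : Module.End 𝕜 X) x) ≤ ‖T‖ * p x := (sInf_bounds_mem T).2 p hp x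

theorem boundedEnd_norm_le {T : boundedEnd Γ} {C : ℝ} (hC : 0 ≤ C)
    (h : ∀ p ∈ Γ, ∀ x, p ((T : Module.End 𝕜 X) x) ≤ C * p x) : ‖T‖ ≤ C := sInf_bounds_le hC h

theorem boundedEnd_norm_one_le : ‖(1 : boundedEnd Γ)‖ ≤ 1 :=
  boundedEnd_norm_le zero_le_one (by simp)

noncomputable instance : NormedAlgebra ℝ (boundedEnd Γ) where
  norm_smul_le r T := by
    refine boundedEnd_norm_le (by positivity) fun p hp x => ?_
    have : ((r • T : boundedEnd Γ) : Module.End 𝕜 X) x = r • (T : Module.End 𝕜 X) x := rfl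
    rw [this, seminorm_real_smul, Real.norm_eq_abs, mul_assoc]
    exact mul_le_mul_of_nonneg_left (seminorm_apply_le T hp x) (abs_nonneg r)

omit [Module ℝ X] [IsScalarTower ℝ 𝕜 X] in
theorem eq_of_tendsto_seminorm {ι : Type*} {l : Filter ι} [l.NeBot] {u : ι → X} {x y : X}
    (hx : ∀ p ∈ Γ, Tendsto (fun n => p (u n - x)) l (𝓝 0))
    (hy : ∀ p ∈ Γ, Tendsto (fun n => p (u n - y)) l (𝓝 0)) : x = y := by
  refine sub_eq_zero.1 (IsSeparating.eq_zero (Γ := Γ) _ fun p hp => le_antisymm ?_ (apply_nonneg _ _))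
  have h := (hx p hp).add (hy p hp)
  rw [add_zero] at h
  refine ge_of_tendsto' h fun n => ?_
  calc p (x - y) = p ((u n - y) - (u n - x)) := by congr 1; abel
    _ ≤ p (u n - y) + p (u n - x) := map_sub_le_add _ _ _
    _ = _ := add_comm _ _

omit [Module ℝ X] [IsScalarTower ℝ 𝕜 X] [IsSeparating Γ] in
theorem tendsto_seminorm {ι : Type*} {l : Filter ι} {u : ι → X} {x : X} {p : Seminorm 𝕜 X}
    (hx : Tendsto (fun n => p (u n - x)) l (𝓝 0)) : Tendsto (fun n => p (u n)) l (𝓝 (p x)) := by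
  rw [tendsto_iff_norm_sub_tendsto_zero]
  exact squeeze_zero (fun _ => norm_nonneg _) (fun n => abs_sub_map_le_sub p (u n) x) hx

omit [Module ℝ X] [IsScalarTower ℝ 𝕜 X] in
/-- The pointwise limit of a sequence of linear maps, with convergence for all seminorms
in `Γ`. -/
theorem exists_linear_limit [IsSeqComplete Γ] (u : ℕ → Module.End 𝕜 X)
    (hu : ∀ x, ∀ p ∈ Γ, ∀ ε : ℝ, 0 < ε → ∃ N, ∀ m ≥ N, ∀ n ≥ N, p (u m x - u n x) < ε) :
    ∃ T : Module.End 𝕜 X, ∀ x, ∀ p ∈ Γ, Tendsto (fun n => p (u n x - T x)) atTop (𝓝 0) := by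
  choose T hT using fun x => IsSeqComplete.exists_lim (Γ := Γ) (fun n => u n x) (hu x)
  refine ⟨{ toFun := T, map_add' := fun x y => ?_, map_smul' := fun c x => ?_ }, hT⟩
  · refine eq_of_tendsto_seminorm (Γ := Γ) (hT (x + y)) fun p hp => ?_
    have h := (hT x p hp).add (hT y p hp)
    rw [add_zero] at h
    refine squeeze_zero (fun _ => apply_nonneg _ _) (fun n => ?_) h
    rw [map_add, add_sub_add_comm]
    exact map_add_le_add _ _ _
  · refine eq_of_tendsto_seminorm (Γ := Γ) (hT (c • x)) fun p hp => ?_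
    have h := (hT x p hp).const_mul ‖c‖
    rw [mul_zero] at h
    refine h.congr fun n => ?_
    rw [map_smul, RingHom.id_apply, ← smul_sub, map_smul_eq_mul]

omit [IsSeparating Γ] in
theorem boundedEnd_sub_apply (S T : boundedEnd Γ) (x : X) :
    ((S - T : boundedEnd Γ) : Module.End 𝕜 X) x = (S : Module.End 𝕜 X) x - (T : Module.End 𝕜 X) x :=
  rfl

instance [IsSeqComplete Γ] : CompleteSpace (boundedEnd Γ) := by
  refine Metric.complete_of_cauchySeq_tendsto fun u hu => ?_
  have hc : ∀ x, ∀ p ∈ Γ, ∀ ε : ℝ, 0 < ε →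
      ∃ N, ∀ m ≥ N, ∀ n ≥ N, p ((u m : Module.End 𝕜 X) x - (u n : Module.End 𝕜 X) x) < ε := by
    intro x p hp ε hε
    obtain ⟨N, hN⟩ := Metric.cauchySeq_iff.1 hu (ε / (p x + 1))
      (by have := apply_nonneg p x; positivity)
    refine ⟨N, fun m hm n hn => ?_⟩
    have h := hN m hm n hn
    rw [dist_eq_norm, lt_div_iff₀ (by have := apply_nonneg p x; positivity)] at h
    have h2 := seminorm_apply_le (u m - u n) hp x
    rw [boundedEnd_sub_apply] at h2
    nlinarith [norm_nonneg (u m - u n)]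
  obtain ⟨T, hT⟩ := exists_linear_limit (Γ := Γ) (fun n => (u n : Module.End 𝕜 X)) hc
  -- Letting `m → ∞` in the Cauchy estimate upgrades pointwise convergence to convergence uniform in
  -- `p` and `x`.
  have key : ∀ ε : ℝ, 0 < ε → ∃ N, ∀ n ≥ N, ∀ p ∈ Γ, ∀ x,
      p ((u n : Module.End 𝕜 X) x - T x) ≤ ε * p x := by
    intro ε hε
    obtain ⟨N, hN⟩ := Metric.cauchySeq_iff.1 hu ε hε
    refine ⟨N, fun n hn p hp x => ?_⟩
    have h : Tendsto (fun m => p ((u n : Module.End 𝕜 X) x - (u m : Module.End 𝕜 X) x)) atTop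
        (𝓝 (p ((u n : Module.End 𝕜 X) x - T x))) := by
      refine tendsto_seminorm ((hT x p hp).congr fun m => ?_)
      rw [map_sub_rev]
      congr 1; abel
    refine le_of_tendsto h ((eventually_ge_atTop N).mono fun m hm => ?_)
    have h2 := seminorm_apply_le (u n - u m) hp x
    rw [boundedEnd_sub_apply] at h2
    have h3 := hN n hn m hm
    rw [dist_eq_norm] at h3
    exact h2.trans (mul_le_mul_of_nonneg_right h3.le (apply_nonneg _ _))
  have hTm : T ∈ boundedEnd Γ := by
    obtain ⟨N, hN⟩ := key 1 one_pos
    have h : (u N : Module.End 𝕜 X) - T ∈ boundedEnd Γ := ⟨1, zero_le_one, hN N le_rfl⟩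
    simpa using sub_mem (u N).2 h
  refine ⟨⟨T, hTm⟩, ?_⟩
  rw [Metric.tendsto_atTop]
  intro ε hε
  obtain ⟨N, hN⟩ := key (ε / 2) (half_pos hε)
  refine ⟨N, fun n hn => ?_⟩
  rw [dist_eq_norm]
  refine lt_of_le_of_lt (boundedEnd_norm_le (half_pos hε).le fun p hp x => ?_) (half_lt_self hε)
  rw [boundedEnd_sub_apply]
  exact hN n hn p hp x

end BoundedEnd

/-! ### Resolvents and Yosida approximants. -/

section HilleYosida

variable {𝕜 X : Type*} [RCLike 𝕜] [AddCommGroup X] [Module 𝕜 X]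
variable [Module ℝ X] [IsScalarTower ℝ 𝕜 X]

instance {Γ : Set (Seminorm 𝕜 X)} : CoeFun (boundedEnd Γ) (fun _ => X → X) :=
  ⟨fun T => (T : Module.End 𝕜 X)⟩

/-- The graph `G` of a densely defined dissipative operator such that `r - G` is onto for
some `r > 0`, with all properties expressed by the seminorms in `Γ`. -/
structure IsMaxDissipative (Γ : Set (Seminorm 𝕜 X)) (G : Submodule 𝕜 (X × X)) : Prop where
  dense : ∀ x, ∀ p ∈ Γ, ∀ ε : ℝ, 0 < ε → ∃ x' y', (x', y') ∈ G ∧ p (x - x') < ε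
  dissipative : ∀ r : ℝ, 0 < r → ∀ x y, (x, y) ∈ G → ∀ p ∈ Γ, r * p x ≤ p (r • x - y)
  surjective : ∃ r : ℝ, 0 < r ∧ ∀ z, ∃ x y, (x, y) ∈ G ∧ r • x - y = z

variable {Γ : Set (Seminorm 𝕜 X)} {G : Submodule 𝕜 (X × X)} [IsSeparating Γ]

omit [Module ℝ X] [IsScalarTower ℝ 𝕜 X] [IsSeparating Γ] in
-- Extends strong convergence to the identity from a dense set of vectors `x'` to all `x`.
theorem map_sub_le_of_contraction {p : Seminorm 𝕜 X} (T : Module.End 𝕜 X)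
    (hT : ∀ x, p (T x) ≤ p x) (x x' : X) : p (T x - x) ≤ 2 * p (x - x') + p (T x' - x') := by
  calc p (T x - x) = p (T (x - x') - (x - x') + (T x' - x')) := by
        congr 1; rw [map_sub]; abel
    _ ≤ p (T (x - x') - (x - x')) + p (T x' - x') := map_add_le_add _ _ _
    _ ≤ p (T (x - x')) + p (x - x') + p (T x' - x') := by gcongr; exact map_sub_le_add _ _ _
    _ ≤ p (x - x') + p (x - x') + p (T x' - x') := by gcongr; exact hT _
    _ = _ := by ring

omit [IsScalarTower ℝ 𝕜 X] in
theorem eq_of_dissipative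
    (hd : ∀ r : ℝ, 0 < r → ∀ x y, (x, y) ∈ G → ∀ p ∈ Γ, r * p x ≤ p (r • x - y))
    {r : ℝ} (hr : 0 < r) {x y x' y' : X} (h : (x, y) ∈ G) (h' : (x', y') ∈ G)
    (he : r • x - y = r • x' - y') : x = x' := by
  refine sub_eq_zero.1 (IsSeparating.eq_zero (Γ := Γ) _ fun p hp => ?_)
  have h1 := hd r hr _ _ (G.sub_mem h h') p hp
  have h2 : r • (x - x') - (y - y') = 0 := by
    rw [smul_sub, ← sub_eq_zero.2 he]; abel
  change r * p (x - x') ≤ p (r • (x - x') - (y - y')) at h1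
  rw [h2, map_zero] at h1
  have := apply_nonneg p (x - x')
  nlinarith

/-- Surjectivity provides a preimage and dissipativity makes it unique, hence linear in `z`. The
bound is the dissipativity estimate at `(R z, r • R z - z)`. -/
theorem exists_resolvent
    (hd : ∀ r : ℝ, 0 < r → ∀ x y, (x, y) ∈ G → ∀ p ∈ Γ, r * p x ≤ p (r • x - y))
    {r : ℝ} (hr : 0 < r) (hs : ∀ z, ∃ x y, (x, y) ∈ G ∧ r • x - y = z) :
    ∃ R : boundedEnd Γ, ‖R‖ ≤ r⁻¹ ∧ ∀ z, (R z, r • R z - z) ∈ G := by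
  choose f g hG he using hs
  have huniq : ∀ x y, (x, y) ∈ G → x = f (r • x - y) := fun x y h =>
    eq_of_dissipative hd hr h (hG _) (he _).symm
  have hg : ∀ z, g z = r • f z - z := fun z => by
    rw [eq_sub_iff_add_eq, ← eq_sub_iff_add_eq', he]
  have hfG : ∀ z, (f z, r • f z - z) ∈ G := fun z => hg z ▸ hG z
  let R : Module.End 𝕜 X :=
    { toFun := f
      map_add' := fun x y => by
        have e : r • (f x + f y) - ((r • f x - x) + (r • f y - y)) = x + y := by
          rw [smul_add]; abel
        exact e ▸ (huniq _ _ (G.add_mem (hfG x) (hfG y))).symm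
      map_smul' := fun c x => by
        have e : r • c • f x - c • (r • f x - x) = c • x := by
          rw [smul_sub, smul_comm c r]; abel
        exact e ▸ (huniq _ _ (G.smul_mem c (hfG x))).symm }
  have hb : ∀ p ∈ Γ, ∀ x, p (R x) ≤ r⁻¹ * p x := by
    intro p hp z
    have h := hd r hr _ _ (hfG z) p hp
    rw [sub_sub_cancel] at h
    rw [inv_mul_eq_div, le_div_iff₀' hr]
    exact h
  exact ⟨⟨R, r⁻¹, (inv_pos.2 hr).le, hb⟩, boundedEnd_norm_le (inv_pos.2 hr).le hb, hfG⟩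

/-- Formally `s - G = (1 - (r - s) R) (r - G)`, and the first factor is inverted by a Neumann
series. -/
theorem surjective_of_abs_sub_lt [IsSeqComplete Γ]
    (hd : ∀ r : ℝ, 0 < r → ∀ x y, (x, y) ∈ G → ∀ p ∈ Γ, r * p x ≤ p (r • x - y))
    {r s : ℝ} (hr : 0 < r) (hs : ∀ z, ∃ x y, (x, y) ∈ G ∧ r • x - y = z) (h : |r - s| < r) :
    ∀ z, ∃ x y, (x, y) ∈ G ∧ s • x - y = z := by
  obtain ⟨R, hR, hG⟩ := exists_resolvent hd hr hs
  have hn : ‖(r - s) • R‖ < 1 := by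
    rw [norm_smul, Real.norm_eq_abs]
    calc |r - s| * ‖R‖ ≤ |r - s| * r⁻¹ := by gcongr
      _ < 1 := by rwa [← div_eq_mul_inv, div_lt_one hr]
  obtain ⟨V, hV⟩ := (isUnit_one_sub_of_norm_lt_one hn).exists_right_inv
  intro z
  refine ⟨R (V z), _, hG (V z), ?_⟩
  have h2 : V z - (r - s) • R (V z) = z := congrArg (fun T : boundedEnd Γ => T z) hV
  conv_rhs => rw [← h2]
  rw [sub_smul]; abel

theorem IsMaxDissipative.surjective_of_pos [IsSeqComplete Γ] (h : IsMaxDissipative Γ G) {s : ℝ}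
    (hs : 0 < s) (z : X) : ∃ x y, (x, y) ∈ G ∧ s • x - y = z := by
  obtain ⟨r, hr, hsurj⟩ := h.surjective
  -- Surjectivity at `r` spreads to the interval `(0, 2r)`. Steps by a factor below two reach
  -- arbitrarily large parameters, and one further step comes down to `s`.
  have hn : ∀ n : ℕ, ∀ z, ∃ x y, (x, y) ∈ G ∧ (r * (3 / 2) ^ n) • x - y = z := by
    intro n
    induction n with
    | zero => simpa using hsurj
    | succ n ih =>
      refine surjective_of_abs_sub_lt h.dissipative (by positivity) ih ?_
      have : 0 < r * (3 / 2) ^ n := by positivity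
      rw [pow_succ, abs_lt]
      constructor <;> linarith
  obtain ⟨n, hlt⟩ := pow_unbounded_of_one_lt (s / r) (by norm_num : (1 : ℝ) < 3 / 2)
  rw [div_lt_iff₀' hr] at hlt
  refine surjective_of_abs_sub_lt h.dissipative (by positivity) (hn n) ?_ z
  rw [abs_lt]
  constructor <;> linarith

/-- `key` is the resolvent identity. Using it in both orders and cancelling `s - r` gives
commutation. -/
theorem resolvent_commute
    (hd : ∀ r : ℝ, 0 < r → ∀ x y, (x, y) ∈ G → ∀ p ∈ Γ, r * p x ≤ p (r • x - y))
    {r s : ℝ} (hr : 0 < r) (hs : 0 < s) {R S : boundedEnd Γ} (hR : ∀ z, (R z, r • R z - z) ∈ G)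
    (hS : ∀ z, (S z, s • S z - z) ∈ G) (hrs : r ≠ s) : Commute R S := by
  have key : ∀ {r s : ℝ}, 0 < r → ∀ {R S : boundedEnd Γ}, (∀ z, (R z, r • R z - z) ∈ G) →
      (∀ z, (S z, s • S z - z) ∈ G) → ∀ z, R z = S z + (s - r) • R (S z) := by
    intro r s hr R S hR hS z
    refine eq_of_dissipative hd hr (hR z)
      (G.add_mem (hS z) (G.smul_of_tower_mem (s - r) (hR (S z)))) ?_
    change r • R z - (r • R z - z) = r • (S z + (s - r) • R (S z)) -
      ((s • S z - z) + (s - r) • (r • R (S z) - S z))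
    module
  refine Subtype.ext (LinearMap.ext fun z => ?_)
  have h1 := key hr hR hS z
  have h2 := key hs hS hR z
  have h3 : (s - r) • (R (S z) - S (R z)) = 0 := by
    have h4 : (s - r) • R (S z) = R z - S z := eq_sub_of_add_eq' h1.symm
    have h5 : (r - s) • S (R z) = S z - R z := eq_sub_of_add_eq' h2.symm
    rw [smul_sub, h4, ← neg_sub r s, neg_smul, h5]; abel
  exact sub_eq_zero.1 ((smul_eq_zero.1 h3).resolve_left (sub_ne_zero.2 hrs.symm))

/-- The Yosida approximants of a maximal dissipative operator. -/
theorem IsMaxDissipative.exists_yosida [IsSeqComplete Γ] (h : IsMaxDissipative Γ G) :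
    ∃ K : ℕ → boundedEnd Γ, (∀ m n, Commute (K m) (K n)) ∧
      (∀ n, ∀ s : ℝ, 0 ≤ s → ‖NormedSpace.exp (s • K n)‖ ≤ 1) ∧
      ∀ x y, (x, y) ∈ G → ∀ p ∈ Γ, Tendsto (fun n => p (K n x - y)) atTop (𝓝 0) := by
  have hpos : ∀ n : ℕ, (0 : ℝ) < n + 1 := fun n => by positivity
  choose R hR hG using fun n : ℕ =>
    exists_resolvent h.dissipative (hpos n) (h.surjective_of_pos (hpos n))
  have hc : ∀ m n, Commute (R m) (R n) := by
    intro m n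
    rcases eq_or_ne m n with rfl | hmn
    · exact Commute.refl _
    · exact resolvent_commute h.dissipative (hpos m) (hpos n) (hG m) (hG n)
        (fun he => hmn (by exact_mod_cast add_right_cancel he))
  -- These contractions tend strongly to the identity: on the domain `S n x - x = R n y`, which is
  -- of order `1 / (n + 1)`. The approximant `(n + 1) (S n - 1)` sends `x` to `S n y`, hence tends
  -- to `y`.
  set S : ℕ → boundedEnd Γ := fun n => (n + 1 : ℝ) • R n with hSdef
  have hS : ∀ n, ‖S n‖ ≤ 1 := by
    intro n
    rw [hSdef, norm_smul, Real.norm_of_nonneg (hpos n).le]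
    calc (n + 1 : ℝ) * ‖R n‖ ≤ (n + 1 : ℝ) * (n + 1 : ℝ)⁻¹ := by gcongr; exact hR n
      _ = 1 := mul_inv_cancel₀ (hpos n).ne'
  have hSp : ∀ n, ∀ p ∈ Γ, ∀ x, p (S n x) ≤ p x := fun n p hp x =>
    (seminorm_apply_le (S n) hp x).trans (mul_le_of_le_one_left (apply_nonneg _ _) (hS n))
  have hSG : ∀ n x y, (x, y) ∈ G → S n x - x = R n y := by
    intro n x y hxy
    have h1 : R n ((n + 1 : ℝ) • x - y) = x := by
      refine eq_of_dissipative h.dissipative (hpos n) (hG n _) hxy ?_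
      abel
    have h2 : (n + 1 : ℝ) • R n x - R n y = x := by
      rw [← LinearMap.map_smul_of_tower, ← map_sub, h1]
    change (n + 1 : ℝ) • R n x - x = R n y
    rw [sub_eq_iff_eq_add, ← sub_eq_iff_eq_add', h2]
  have hS1 : ∀ z, ∀ p ∈ Γ, Tendsto (fun n => p (S n z - z)) atTop (𝓝 0) := by
    intro z p hp
    rw [Metric.tendsto_atTop]
    intro ε hε
    obtain ⟨x, y, hxy, hlt⟩ := h.dense z p hp (ε / 4) (by positivity)
    obtain ⟨N, hN⟩ := exists_nat_gt (p y / (ε / 2))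
    refine ⟨N, fun n hn => ?_⟩
    rw [Real.dist_eq, sub_zero, abs_of_nonneg (apply_nonneg _ _)]
    have h1 := map_sub_le_of_contraction (S n : Module.End 𝕜 X) (hSp n p hp) z x
    have h2 : p (S n x - x) < ε / 2 := by
      rw [hSG n x y hxy]
      have h3 : p (R n y) ≤ (n + 1 : ℝ)⁻¹ * p y :=
        (seminorm_apply_le (R n) hp y).trans
          (mul_le_mul_of_nonneg_right (hR n) (apply_nonneg _ _))
      refine h3.trans_lt ?_
      rw [inv_mul_eq_div, div_lt_iff₀ (hpos n)]
      rw [div_lt_iff₀ (by positivity)] at hN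
      have : (N : ℝ) ≤ n := by exact_mod_cast hn
      nlinarith
    linarith
  refine ⟨fun n => (n + 1 : ℝ) • (S n - 1), fun m n => ?_, fun n s hs =>
    norm_exp_smul_sub_one_le boundedEnd_norm_one_le (hS n) (hpos n).le hs, fun x y hxy p hp => ?_⟩
  · have hSc : Commute (S m) (S n) := ((hc m n).smul_left _).smul_right _
    exact (((hSc.sub_left (Commute.one_left _)).sub_right
      ((Commute.one_right _))).smul_left _).smul_right _
  · refine (hS1 y p hp).congr fun n => ?_
    have : ((n + 1 : ℝ) • (S n - 1)) x = S n y := by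
      change (n + 1 : ℝ) • (S n x - x) = (n + 1 : ℝ) • R n y
      rw [hSG n x y hxy]
    rw [this]

end HilleYosida

/-! ### The semigroup as a limit of exponentials, and its generator. -/

section HilleYosida

variable {𝕜 X : Type*} [RCLike 𝕜] [AddCommGroup X] [Module 𝕜 X]
variable [Module ℝ X] [IsScalarTower ℝ 𝕜 X]
variable {Γ : Set (Seminorm 𝕜 X)} {G : Submodule 𝕜 (X × X)} [IsSeparating Γ]

theorem seminorm_apply_le_self {T : boundedEnd Γ} (hT : ‖T‖ ≤ 1) {p : Seminorm 𝕜 X} (hp : p ∈ Γ)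
    (x : X) : p (T x) ≤ p x :=
  (seminorm_apply_le T hp x).trans (mul_le_of_le_one_left (apply_nonneg _ _) hT)

theorem seminorm_exp_sub_exp_le [IsSeqComplete Γ] {K L : boundedEnd Γ} (hKL : Commute K L)
    (hK : ∀ s : ℝ, 0 ≤ s → ‖NormedSpace.exp (s • K)‖ ≤ 1)
    (hL : ∀ s : ℝ, 0 ≤ s → ‖NormedSpace.exp (s • L)‖ ≤ 1) {t : ℝ} (ht : 0 ≤ t)
    {p : Seminorm 𝕜 X} (hp : p ∈ Γ) (x y : X) :
    p (NormedSpace.exp (t • K) x - NormedSpace.exp (t • L) x) ≤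
      t * (p (K x - y) + p (L x - y)) := by
  obtain ⟨D, hD, hDt⟩ := exp_smul_sub_exp_smul_eq_mul hKL hK hL ht
  have h1 : NormedSpace.exp (t • K) x - NormedSpace.exp (t • L) x = D (K x - L x) :=
    congrArg (fun T : boundedEnd Γ => T x) hD
  rw [h1]
  calc p (D (K x - L x)) ≤ ‖D‖ * p (K x - L x) := seminorm_apply_le D hp _
    _ ≤ t * p (K x - L x) := mul_le_mul_of_nonneg_right hDt (apply_nonneg _ _)
    _ ≤ t * (p (K x - y) + p (L x - y)) := by
        refine mul_le_mul_of_nonneg_left ?_ ht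
        rw [← sub_sub_sub_cancel_right (K x) (L x) y]
        exact map_sub_le_add _ _ _

theorem seminorm_exp_sub_self_le [IsSeqComplete Γ] {K : boundedEnd Γ}
    (hK : ∀ s : ℝ, 0 ≤ s → ‖NormedSpace.exp (s • K)‖ ≤ 1) {t : ℝ} (ht : 0 ≤ t)
    {p : Seminorm 𝕜 X} (hp : p ∈ Γ) (x : X) :
    p (NormedSpace.exp (t • K) x - x) ≤ t * p (K x) := by
  obtain ⟨D, _, hD, _, hDt, _⟩ := exp_smul_taylor hK ht
  have h1 : NormedSpace.exp (t • K) x - x = D (K x) :=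
    congrArg (fun T : boundedEnd Γ => T x) hD
  rw [h1]
  exact (seminorm_apply_le D hp _).trans (mul_le_mul_of_nonneg_right hDt (apply_nonneg _ _))

/-- The second-order remainder is applied to `y` instead of `K x`. With `y` in the domain, `K y`
stays bounded along the Yosida approximants, whereas `K (K x)` need not. -/
theorem seminorm_exp_sub_sub_le [IsSeqComplete Γ] {K : boundedEnd Γ}
    (hK : ∀ s : ℝ, 0 ≤ s → ‖NormedSpace.exp (s • K)‖ ≤ 1) {t : ℝ} (ht : 0 ≤ t)
    {p : Seminorm 𝕜 X} (hp : p ∈ Γ) (x y : X) :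
    p (NormedSpace.exp (t • K) x - x - t • K x) ≤ 2 * t * p (K x - y) + t ^ 2 * p (K y) := by
  obtain ⟨D, E, hD, hE, hDt, hEt⟩ := exp_smul_taylor hK ht
  have h1 : NormedSpace.exp (t • K) x - x = D (K x) :=
    congrArg (fun T : boundedEnd Γ => T x) hD
  have h2 : D y - t • y = E (K y) := congrArg (fun T : boundedEnd Γ => T y) hE
  have h3 : D (K x) - t • K x = (D (K x - y) - t • (K x - y)) + E (K y) := by
    rw [← h2, map_sub, smul_sub]; abel
  rw [h1, h3]
  calc _ ≤ p (D (K x - y)) + p (t • (K x - y)) + p (E (K y)) :=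
        (map_add_le_add _ _ _).trans (by gcongr; exact map_sub_le_add _ _ _)
    _ ≤ t * p (K x - y) + t * p (K x - y) + t ^ 2 * p (K y) := by
        rw [seminorm_real_smul, abs_of_nonneg ht]
        gcongr
        · exact (seminorm_apply_le D hp _).trans
            (mul_le_mul_of_nonneg_right hDt (apply_nonneg _ _))
        · exact (seminorm_apply_le E hp _).trans
            (mul_le_mul_of_nonneg_right hEt (apply_nonneg _ _))
    _ = _ := by ring

/-- The Hille–Yosida theorem for semigroups that are contractive for all seminorms in `Γ`. -/
theorem IsMaxDissipative.exists_semigroup [IsSeqComplete Γ] (h : IsMaxDissipative Γ G) :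
    ∃ T : ℝ≥0 → X →ₗ[𝕜] X, IsSemigroup T ∧ (∀ p ∈ Γ, ∀ s x, p (T s x) ≤ p x) ∧
      (∀ x, ∀ p ∈ Γ, Tendsto (fun s : ℝ≥0 => p (T s x - x)) (𝓝 0) (𝓝 0)) ∧
      ∀ x y, (x, y) ∈ G → ∀ p ∈ Γ,
        Tendsto (fun s : ℝ≥0 => p ((s : ℝ)⁻¹ • (T s x - x) - y)) (𝓝[>] 0) (𝓝 0) := by
  obtain ⟨K, hcomm, hK, hlim⟩ := h.exists_yosida
  set E : ℕ → ℝ≥0 → boundedEnd Γ := fun n t => NormedSpace.exp ((t : ℝ) • K n)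
  have hE1 : ∀ n t, ∀ p ∈ Γ, ∀ x, p (E n t x) ≤ p x := fun n t p hp x =>
    seminorm_apply_le_self (hK n t t.2) hp x
  -- On the domain Duhamel's estimate applies; the general case follows by density because all `E n
  -- t` are contractions for `p`.
  have hcauchy : ∀ t : ℝ≥0, ∀ x, ∀ p ∈ Γ, ∀ ε : ℝ, 0 < ε →
      ∃ N, ∀ m ≥ N, ∀ n ≥ N, p (E m t x - E n t x) < ε := by
    intro t x p hp ε hε
    obtain ⟨x', y', hxy, hlt⟩ := h.dense x p hp (ε / 4) (by positivity)
    have hev : ∀ᶠ n in atTop, (t : ℝ) * p (K n x' - y') < ε / 4 := by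
      have h1 := (hlim x' y' hxy p hp).const_mul (t : ℝ)
      rw [mul_zero] at h1
      exact h1.eventually_lt_const (by positivity)
    obtain ⟨N, hN⟩ := eventually_atTop.1 hev
    refine ⟨N, fun m hm n hn => ?_⟩
    have h2 := seminorm_exp_sub_exp_le (hcomm m n) (hK m) (hK n) t.2 hp x' y'
    have h3 : E m t x - E n t x = E m t (x - x') - E n t (x - x') + (E m t x' - E n t x') := by
      rw [map_sub, map_sub]; abel
    have h4 : p (E m t x - E n t x) ≤ p (E m t (x - x')) + p (E n t (x - x')) +
        p (E m t x' - E n t x') := by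
      rw [h3]
      exact (map_add_le_add _ _ _).trans (by gcongr; exact map_sub_le_add _ _ _)
    have h5 := hE1 m t p hp (x - x')
    have h6 := hE1 n t p hp (x - x')
    have h7 := hN m hm
    have h8 := hN n hn
    have h9 : p (E m t x' - E n t x') ≤ t * p (K m x' - y') + t * p (K n x' - y') := by
      rw [← mul_add]; exact h2
    linarith
  choose T hT using fun t : ℝ≥0 =>
    exists_linear_limit (Γ := Γ) (fun n => (E n t : Module.End 𝕜 X)) (hcauchy t)
  have hT1 : ∀ p ∈ Γ, ∀ s x, p (T s x) ≤ p x := fun p hp s x =>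
    le_of_tendsto' (tendsto_seminorm (hT s x p hp)) fun n => hE1 n s p hp x
  have hmem : ∀ x y, (x, y) ∈ G → ∀ p ∈ Γ, ∀ s : ℝ≥0, p (T s x - x) ≤ s * p y := by
    intro x y hxy p hp s
    have h1 : Tendsto (fun n => p (E n s x - x)) atTop (𝓝 (p (T s x - x))) :=
      tendsto_seminorm ((hT s x p hp).congr fun n => by rw [sub_sub_sub_cancel_right])
    exact le_of_tendsto_of_tendsto' h1 ((tendsto_seminorm (hlim x y hxy p hp)).const_mul (s : ℝ))
      fun n => seminorm_exp_sub_self_le (hK n) s.2 hp x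
  -- Here `y'` is a domain vector near `y`, so dividing by `s` leaves an error governed by `p (y -
  -- y')` as `s → 0`.
  have hgen : ∀ x y, (x, y) ∈ G → ∀ y' z', (y', z') ∈ G → ∀ p ∈ Γ, ∀ s : ℝ≥0,
      p (T s x - x - (s : ℝ) • y) ≤ 2 * s * p (y - y') + (s : ℝ) ^ 2 * p z' := by
    intro x y hxy y' z' hyz p hp s
    have h1 : Tendsto (fun n => p (E n s x - x - (s : ℝ) • K n x)) atTop
        (𝓝 (p (T s x - x - (s : ℝ) • y))) := by
      have h2 := (hT s x p hp).add ((hlim x y hxy p hp).const_mul (s : ℝ))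
      rw [mul_zero, add_zero] at h2
      refine tendsto_seminorm (squeeze_zero (fun _ => apply_nonneg _ _) (fun n => ?_) h2)
      have h3 : E n s x - x - (s : ℝ) • K n x - (T s x - x - (s : ℝ) • y) =
          (E n s x - T s x) - (s : ℝ) • (K n x - y) := by
        rw [smul_sub]; abel
      rw [h3]
      refine (map_sub_le_add _ _ _).trans ?_
      rw [seminorm_real_smul, NNReal.abs_eq]
    have h4 : Tendsto (fun n => p (K n x - y')) atTop (𝓝 (p (y - y'))) :=
      tendsto_seminorm ((hlim x y hxy p hp).congr fun n => by rw [sub_sub_sub_cancel_right])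
    exact le_of_tendsto_of_tendsto' h1 ((h4.const_mul (2 * (s : ℝ))).add
      ((tendsto_seminorm (hlim y' z' hyz p hp)).const_mul ((s : ℝ) ^ 2)))
      fun n => seminorm_exp_sub_sub_le (hK n) s.2 hp x y'
  refine ⟨T, ⟨?_, ?_⟩, hT1, ?_, ?_⟩
  · refine LinearMap.ext fun x => eq_of_tendsto_seminorm (Γ := Γ) (hT 0 x) fun p hp => ?_
    have : ∀ n, E n 0 = 1 := fun n => by simp [E]
    simp [this]
  · intro s u
    have hadd : ∀ n, E n (s + u) = E n s * E n u := fun n => by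
      let : NormedAlgebra ℚ (boundedEnd Γ) := NormedAlgebra.restrictScalars ℚ ℝ _
      simp only [E, NNReal.coe_add, add_smul]
      exact NormedSpace.exp_add_of_commute (((Commute.refl (K n)).smul_left _).smul_right _)
    refine LinearMap.ext fun x => eq_of_tendsto_seminorm (Γ := Γ) (hT (s + u) x) fun p hp => ?_
    have h1 := (hT u x p hp).add (hT s (T u x) p hp)
    rw [add_zero] at h1
    refine squeeze_zero (fun _ => apply_nonneg _ _) (fun n => ?_) h1
    have h2 : E n (s + u) x - (T s ∘ₗ T u) x =
        E n s (E n u x - T u x) + (E n s (T u x) - T s (T u x)) := by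
      rw [hadd, map_sub, sub_add_sub_cancel]; rfl
    rw [h2]
    exact (map_add_le_add _ _ _).trans (by gcongr; exact hE1 n s p hp _)
  · intro x p hp
    rw [Metric.tendsto_nhds]
    intro ε hε
    obtain ⟨x', y', hxy, hlt⟩ := h.dense x p hp (ε / 4) (by positivity)
    have h1 : Tendsto (fun s : ℝ≥0 => (s : ℝ) * p y') (𝓝 0) (𝓝 0) := by
      have : Continuous fun s : ℝ≥0 => (s : ℝ) * p y' := by fun_prop
      simpa using this.tendsto 0
    filter_upwards [h1.eventually_lt_const (half_pos hε)] with s hs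
    rw [Real.dist_eq, sub_zero, abs_of_nonneg (apply_nonneg _ _)]
    have h2 := map_sub_le_of_contraction (T s) (hT1 p hp s) x x'
    have h3 := hmem x' y' hxy p hp s
    linarith
  · intro x y hxy p hp
    rw [Metric.tendsto_nhds]
    intro ε hε
    obtain ⟨y', z', hyz, hlt⟩ := h.dense y p hp (ε / 4) (by positivity)
    have h1 : Tendsto (fun s : ℝ≥0 => (s : ℝ) * p z') (𝓝 0) (𝓝 0) := by
      have : Continuous fun s : ℝ≥0 => (s : ℝ) * p z' := by fun_prop
      simpa using this.tendsto 0
    filter_upwards [nhdsWithin_le_nhds (h1.eventually_lt_const (half_pos hε)),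
      self_mem_nhdsWithin] with s hs hs0
    have hs0' : (0 : ℝ) < s := hs0
    rw [Real.dist_eq, sub_zero, abs_of_nonneg (apply_nonneg _ _)]
    have h2 : (s : ℝ)⁻¹ • (T s x - x) - y = (s : ℝ)⁻¹ • (T s x - x - (s : ℝ) • y) := by
      rw [smul_sub _ (T s x - x), inv_smul_smul₀ hs0'.ne']
    rw [h2, seminorm_real_smul, abs_of_pos (inv_pos.2 hs0'), inv_mul_eq_div, div_lt_iff₀ hs0']
    have h3 := hgen x y hxy y' z' hyz p hp s
    nlinarith

/-- An operator is the whole generator if it is maximal dissipative and contained in the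
generator of a contraction semigroup. -/
theorem IsMaxDissipative.mem_of_tendsto (h : IsMaxDissipative Γ G) {T : ℝ≥0 → X →ₗ[𝕜] X}
    (hT : ∀ p ∈ Γ, ∀ s x, p (T s x) ≤ p x)
    (hG : ∀ x y, (x, y) ∈ G → ∀ p ∈ Γ,
      Tendsto (fun s : ℝ≥0 => p ((s : ℝ)⁻¹ • (T s x - x) - y)) (𝓝[>] 0) (𝓝 0)) {x y : X}
    (hxy : ∀ p ∈ Γ,
      Tendsto (fun s : ℝ≥0 => p ((s : ℝ)⁻¹ • (T s x - x) - y)) (𝓝[>] 0) (𝓝 0)) :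
    (x, y) ∈ G := by
  obtain ⟨r, hr, hs⟩ := h.surjective
  -- If `w = x - x'`, then the orbit of `w` has derivative `r • w` at zero. A contraction semigroup
  -- cannot make `p w` grow at rate `r`, so `p w = 0`.
  obtain ⟨x', y', hG', he⟩ := hs (r • x - y)
  have hdiff : ∀ p ∈ Γ, Tendsto (fun s : ℝ≥0 => p ((s : ℝ)⁻¹ • (T s (x - x') - (x - x')) -
      (y - y'))) (𝓝[>] 0) (𝓝 0) := by
    intro p hp
    have h1 := (hxy p hp).add (hG x' y' hG' p hp)
    rw [add_zero] at h1
    refine squeeze_zero (fun _ => apply_nonneg _ _) (fun s => ?_) h1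
    refine le_of_eq_of_le (congrArg p ?_) (map_sub_le_add p _ _)
    simp only [map_sub, smul_sub]
    abel
  have hy : y - y' = r • (x - x') := by
    rw [smul_sub, sub_eq_sub_iff_sub_eq_sub, ← neg_sub (r • x) y, ← he]; abel
  have hx : x - x' = 0 := by
    refine IsSeparating.eq_zero (Γ := Γ) _ fun p hp => le_antisymm ?_ (apply_nonneg _ _)
    have h1 := hdiff p hp
    rw [hy] at h1
    have h2 : r * p (x - x') ≤ 0 := by
      refine ge_of_tendsto h1 ?_
      filter_upwards [self_mem_nhdsWithin] with s hs0
      have hs0' : (0 : ℝ) < s := hs0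
      set w := x - x'
      have h3 : (s : ℝ)⁻¹ • (T s w - w) - r • w = (s : ℝ)⁻¹ • T s w - ((s : ℝ)⁻¹ + r) • w := by
        rw [smul_sub, add_smul]; abel
      have h4 : p (((s : ℝ)⁻¹ + r) • w) - p ((s : ℝ)⁻¹ • T s w) ≤
          p ((s : ℝ)⁻¹ • (T s w - w) - r • w) := by
        rw [h3, map_sub_rev p]
        exact (le_abs_self _).trans (abs_sub_map_le_sub p _ _)
      rw [seminorm_real_smul, seminorm_real_smul, abs_of_pos (by positivity),
        abs_of_pos (by positivity)] at h4
      have h5 : (s : ℝ)⁻¹ * p (T s w) ≤ (s : ℝ)⁻¹ * p w :=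
        mul_le_mul_of_nonneg_left (hT p hp s w) (by positivity)
      linarith
    by_contra hc
    exact absurd h2 (not_le.2 (mul_pos hr (not_le.1 hc)))
  rw [hx, smul_zero] at hy
  rw [sub_eq_zero.1 hx, sub_eq_zero.1 hy]
  exact hG'

end HilleYosida

/-! ### Directed systems, completeness and closed dissipative graphs. -/

section LumerPhillips

variable {𝕜 X : Type*} [RCLike 𝕜] [AddCommGroup X] [Module 𝕜 X] {Γ : Set (Seminorm 𝕜 X)}

theorem IsDirectedSystem.withSeminorms [t : TopologicalSpace X] (h : IsDirectedSystem t Γ) :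
    WithSeminorms (fun p : Γ => (p : Seminorm 𝕜 X)) := ⟨h.generates⟩

theorem IsDirectedSystem.tendsto_iff [t : TopologicalSpace X] (h : IsDirectedSystem t Γ)
    {ι : Type*} {l : Filter ι} {u : ι → X} {x : X} :
    Tendsto u l (𝓝 x) ↔ ∀ p ∈ Γ, Tendsto (fun i => p (u i - x)) l (𝓝 0) := by
  rw [h.withSeminorms.tendsto_nhds]
  simp only [Subtype.forall, Metric.tendsto_nhds, Real.dist_eq, sub_zero]
  simp only [abs_of_nonneg (apply_nonneg _ _)]

theorem IsDirectedSystem.continuous [t : TopologicalSpace X] (h : IsDirectedSystem t Γ)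
    {p : Seminorm 𝕜 X} (hp : p ∈ Γ) : Continuous p :=
  h.withSeminorms.continuous_seminorm ⟨p, hp⟩

theorem IsDirectedSystem.isSeparating [t : TopologicalSpace X] [T1Space X]
    (h : IsDirectedSystem t Γ) : IsSeparating Γ where
  eq_zero x hx := by
    by_contra hne
    obtain ⟨p, hp⟩ := h.withSeminorms.separating_of_T1 x hne
    exact hp (hx p p.2)

theorem IsDirectedSystem.exists_finset_sup_le {t : TopologicalSpace X} (h : IsDirectedSystem t Γ)
    (s : Finset Γ) : ∃ r ∈ Γ, ∃ C : ℝ, 0 ≤ C ∧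
      ∀ x, s.sup (fun p : Γ => (p : Seminorm 𝕜 X)) x ≤ C * r x := by
  classical
  induction s using Finset.induction_on with
  | empty =>
    obtain ⟨r, hr⟩ := h.nonempty
    exact ⟨r, hr, 0, le_rfl, fun x => by simp⟩
  | insert p s _ ih =>
    obtain ⟨r, hr, C, hC, hs⟩ := ih
    obtain ⟨q, hq, D, hD, hmax⟩ := h.directed p p.2 r hr
    -- The factor `1 + C` dominates both `1`, needed for `p`, and `C`, needed for the earlier
    -- supremum.
    refine ⟨q, hq, (1 + C) * D, by positivity, fun x => ?_⟩
    rw [Finset.sup_insert, Seminorm.sup_apply]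
    have h1 := (le_max_left _ _).trans (hmax x)
    have h2 := (le_max_right _ _).trans (hmax x)
    have h3 : 0 ≤ D * q x := mul_nonneg hD (apply_nonneg _ _)
    refine max_le ?_ ?_
    · nlinarith
    · refine (hs x).trans ?_
      nlinarith

/-- A continuous seminorm is dominated by a member of a directed system that generates the
topology. -/
theorem IsDirectedSystem.exists_le_of_continuous [t : TopologicalSpace X]
    (h : IsDirectedSystem t Γ) {q : Seminorm 𝕜 X} (hq : Continuous q) :
    ∃ r ∈ Γ, ∃ C : ℝ, 0 ≤ C ∧ ∀ x, q x ≤ C * r x := by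
  obtain ⟨s, C, -, hs⟩ := Seminorm.bound_of_continuous h.withSeminorms q hq
  obtain ⟨r, hr, D, hD, hr'⟩ := h.exists_finset_sup_le s
  refine ⟨r, hr, C * D, by positivity, fun x => (hs x).trans ?_⟩
  rw [mul_assoc]
  exact mul_le_mul_of_nonneg_left (hr' x) C.2

variable [Module ℝ X] [IsScalarTower ℝ 𝕜 X]

theorem ofReal_smul (r : ℝ) (x : X) : (r : 𝕜) • x = r • x :=
  algebraMap_smul 𝕜 r x

/-- A submodule with dense domain whose elements satisfy the dissipativity estimate is the graph
of an operator. -/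
theorem eq_zero_of_dissipative [IsSeparating Γ] {G : Submodule 𝕜 (X × X)}
    (hdense : ∀ x, ∀ p ∈ Γ, ∀ ε : ℝ, 0 < ε → ∃ x' y', (x', y') ∈ G ∧ p (x - x') < ε)
    (hd : ∀ r : ℝ, 0 < r → ∀ x y, (x, y) ∈ G → ∀ p ∈ Γ, r * p x ≤ p (r • x - y))
    {y : X} (hy : (0, y) ∈ G) : y = 0 := by
  refine IsSeparating.eq_zero (Γ := Γ) _ fun p hp => le_antisymm ?_ (apply_nonneg _ _)
  -- Dissipativity is applied to `(u, v) + r • (0, y)`, divided by `r`, and `r → ∞`. Choosing `u`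
  -- close to `y` then forces `p y = 0`.
  have key : ∀ u v, (u, v) ∈ G → p u ≤ p (y - u) := by
    intro u v huv
    have h1 : ∀ r : ℝ, 0 < r → p u ≤ p (y - u) + r⁻¹ * p v := by
      intro r hr
      have h2 := hd r hr _ _ (G.add_mem huv (G.smul_of_tower_mem r hy)) p hp
      have h3 : r * p u ≤ r * p (y - u) + p v := by
        calc r * p u = r * p (u + r • (0 : X)) := by rw [smul_zero, add_zero]
          _ ≤ p (r • (u + r • (0 : X)) - (v + r • y)) := h2
          _ = p (r • (u - y) - v) := by
              congr 1; rw [smul_zero, add_zero, smul_sub]; abel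
          _ ≤ p (r • (u - y)) + p v := map_sub_le_add _ _ _
          _ = r * p (y - u) + p v := by
              rw [seminorm_real_smul, abs_of_pos hr, map_sub_rev p]
      rw [inv_mul_eq_div, ← sub_le_iff_le_add', le_div_iff₀ hr]
      linarith
    have h4 : Tendsto (fun r : ℝ => p (y - u) + r⁻¹ * p v) atTop (𝓝 (p (y - u) + 0 * p v)) :=
      tendsto_const_nhds.add (tendsto_inv_atTop_zero.mul_const _)
    rw [zero_mul, add_zero] at h4
    exact ge_of_tendsto h4 ((eventually_gt_atTop 0).mono h1)
  refine le_of_forall_pos_lt_add fun ε hε => ?_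
  obtain ⟨u, v, huv, hlt⟩ := hdense y p hp (ε / 2) (half_pos hε)
  have h1 := key u v huv
  have h2 : p y ≤ p (y - u) + p u := by
    simpa using map_add_le_add p (y - u) u
  linarith

omit [Module ℝ X] [IsScalarTower ℝ 𝕜 X] in
/-- Completeness in terms of a directed system of seminorms. -/
theorem IsDirectedSystem.exists_le_nhds [t : TopologicalSpace X] [IsTopologicalAddGroup X]
    (h : IsDirectedSystem t Γ)
    (hc : @CompleteSpace X (IsTopologicalAddGroup.rightUniformSpace X)) (F : Filter X) [F.NeBot]
    (hF : ∀ p ∈ Γ, Tendsto (fun z : X × X => p (z.2 - z.1)) (F ×ˢ F) (𝓝 0)) : ∃ x, F ≤ 𝓝 x := by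
  have h1 : Tendsto (fun z : X × X => z.2 - z.1) (F ×ˢ F) (𝓝 0) := by
    rw [h.tendsto_iff]
    simpa using hF
  let := IsTopologicalAddGroup.rightUniformSpace X
  have : IsUniformAddGroup X := isUniformAddGroup_of_addCommGroup
  refine CompleteSpace.complete ⟨inferInstance, ?_⟩
  rw [uniformity_eq_comap_nhds_zero]
  exact tendsto_iff_comap.1 h1

omit [Module ℝ X] [IsScalarTower ℝ 𝕜 X] in
theorem IsDirectedSystem.isSeqComplete [t : TopologicalSpace X] [IsTopologicalAddGroup X]
    (h : IsDirectedSystem t Γ)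
    (hc : @CompleteSpace X (IsTopologicalAddGroup.rightUniformSpace X)) : IsSeqComplete Γ where
  exists_lim u hu := by
    obtain ⟨x, hx⟩ := h.exists_le_nhds hc (map u atTop) fun p hp => by
      rw [prod_map_map_eq, tendsto_map'_iff, prod_atTop_atTop_eq, Metric.tendsto_atTop]
      intro ε hε
      obtain ⟨N, hN⟩ := hu p hp ε hε
      refine ⟨(N, N), fun n hn => ?_⟩
      rw [Real.dist_eq, sub_zero, Function.comp_apply, abs_of_nonneg (apply_nonneg _ _)]
      exact hN _ hn.2 _ hn.1
    exact ⟨x, h.tendsto_iff.1 hx⟩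

/-- Dissipativity makes preimages of a convergent filter Cauchy, so closedness of `G` makes the
range closed. Filters replace sequences because the topology need not be metrizable. -/
theorem surjective_of_dense_range [t : TopologicalSpace X] [IsTopologicalAddGroup X]
    [ContinuousSMul 𝕜 X] (h : IsDirectedSystem t Γ)
    (hc : @CompleteSpace X (IsTopologicalAddGroup.rightUniformSpace X))
    {G : Submodule 𝕜 (X × X)} (hG : IsClosed (G : Set (X × X))) {r : ℝ} (hr : 0 < r)
    (hd : ∀ x y, (x, y) ∈ G → ∀ p ∈ Γ, r * p x ≤ p (r • x - y))
    (hdense : Dense {z | ∃ x y, (x, y) ∈ G ∧ r • x - y = z}) (z : X) :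
    ∃ x y, (x, y) ∈ G ∧ r • x - y = z := by
  have : ContinuousConstSMul ℝ X := ⟨fun r => by
    simp only [← ofReal_smul (𝕜 := 𝕜)]
    exact continuous_const_smul _⟩
  set φ : X × X → X := fun w => r • w.1 - w.2
  -- The filter of graph points `(x, y)` along which `r • x - y` tends to `z`.
  set l : Filter (X × X) := comap φ (𝓝 z) ⊓ 𝓟 (G : Set (X × X))
  have hl : l.NeBot := by
    refine inf_principal_neBot_iff.2 fun U hU => ?_
    obtain ⟨V, hV, hVU⟩ := hU
    obtain ⟨_, hwV, x, y, hxy, rfl⟩ := mem_closure_iff_nhds.1 (hdense z) V hV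
    exact ⟨(x, y), hVU hwV, hxy⟩
  have hφ : Tendsto φ l (𝓝 z) := tendsto_comap.mono_left inf_le_left
  have hlG : ∀ᶠ w in l, w ∈ G := mem_inf_of_right (mem_principal_self _)
  obtain ⟨x, hx⟩ := h.exists_le_nhds hc (map Prod.fst l) fun p hp => by
    rw [prod_map_map_eq, tendsto_map'_iff]
    have h1 : Tendsto (fun w : (X × X) × (X × X) => r⁻¹ * p (φ w.2 - φ w.1)) (l ×ˢ l) (𝓝 0) := by
      have h2 : Tendsto (fun w : (X × X) × (X × X) => φ w.2 - φ w.1) (l ×ˢ l) (𝓝 (z - z)) :=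
        (hφ.comp tendsto_snd).sub (hφ.comp tendsto_fst)
      have h3 := (((h.continuous hp).tendsto _).comp h2).const_mul r⁻¹
      simpa using h3
    refine squeeze_zero' (Eventually.of_forall fun _ => apply_nonneg _ _) ?_ h1
    filter_upwards [hlG.prod_mk hlG] with w hw
    have h4 := hd _ _ (G.sub_mem hw.2 hw.1) p hp
    rw [inv_mul_eq_div, le_div_iff₀' hr]
    refine h4.trans (le_of_eq (congrArg p ?_))
    change r • (w.2.1 - w.1.1) - (w.2.2 - w.1.2) = r • w.2.1 - w.2.2 - (r • w.1.1 - w.1.2)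
    rw [smul_sub]; abel
  have hfst : Tendsto Prod.fst l (𝓝 x) := hx
  have hsnd : Tendsto Prod.snd l (𝓝 (r • x - z)) :=
    ((hfst.const_smul r).sub hφ).congr fun w => by simp [φ]
  refine ⟨x, r • x - z, hG.mem_of_tendsto (hfst.prodMk_nhds hsnd) hlG, by abel⟩

end LumerPhillips

/-! ### The Lumer–Phillips theorem. -/

section LumerPhillips

variable {𝕜 X : Type*} [RCLike 𝕜] [AddCommGroup X] [Module 𝕜 X] {Γ : Set (Seminorm 𝕜 X)}

theorem isStronglyContinuous_of_contraction [t : TopologicalSpace X] (h : IsDirectedSystem t Γ)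
    {T : ℝ≥0 → X →ₗ[𝕜] X} (hT : IsSemigroup T) (hc : ∀ p ∈ Γ, ∀ s x, p (T s x) ≤ p x)
    (h0 : ∀ x, ∀ p ∈ Γ, Tendsto (fun s : ℝ≥0 => p (T s x - x)) (𝓝 0) (𝓝 0)) :
    IsStronglyContinuous t T := by
  intro x
  have hadd : ∀ p ∈ Γ, ∀ a b, p (T (a + b) x - T a x) ≤ p (T b x - x) := by
    intro p hp a b
    rw [hT.add, LinearMap.comp_apply, ← map_sub]
    exact hc p hp _ _
  refine continuous_iff_continuousAt.2 fun s₀ => h.tendsto_iff.2 fun p hp => ?_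
  -- With truncated subtraction this sum is `|s - s₀|`, which treats both sides of `s₀` at once.
  have hd : Tendsto (fun s : ℝ≥0 => (s - s₀) + (s₀ - s)) (𝓝 s₀) (𝓝 0) := by
    have : Continuous fun s : ℝ≥0 => (s - s₀) + (s₀ - s) := by fun_prop
    simpa using this.tendsto s₀
  refine squeeze_zero (fun _ => apply_nonneg _ _) (fun s => ?_) ((h0 x p hp).comp hd)
  simp only [Function.comp_apply]
  rcases le_total s s₀ with hs | hs
  · rw [tsub_eq_zero_of_le hs, zero_add, map_sub_rev p]
    conv_lhs => rw [← add_tsub_cancel_of_le hs]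
    exact hadd p hp _ _
  · rw [tsub_eq_zero_of_le hs, add_zero]
    conv_lhs => rw [← add_tsub_cancel_of_le hs]
    exact hadd p hp _ _

/-- For fixed `r` and `p` the estimate is a closed condition on the pair `(x, y)`. -/
theorem le_of_mem_closure_graph [Module ℝ X] [IsScalarTower ℝ 𝕜 X] [t : TopologicalSpace X]
    [IsTopologicalAddGroup X] [ContinuousSMul 𝕜 X] (h : IsDirectedSystem t Γ) {A : X →ₗ.[𝕜] X}
    (hA : IsDissipative Γ A) (r : ℝ) (hr : 0 < r) (x y : X)
    (hxy : (x, y) ∈ A.graph.topologicalClosure) (p : Seminorm 𝕜 X) (hp : p ∈ Γ) :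
    r * p x ≤ p (r • x - y) := by
  have hc : IsClosed {w : X × X | r * p w.1 ≤ p ((r : 𝕜) • w.1 - w.2)} := by
    have := h.continuous hp
    exact isClosed_le (by fun_prop) (by fun_prop)
  have hs : (A.graph : Set (X × X)) ⊆ {w : X × X | r * p w.1 ≤ p ((r : 𝕜) • w.1 - w.2)} := by
    rintro w hw
    obtain ⟨u, hu, hu'⟩ := (LinearPMap.mem_graph_iff A).1 hw
    change r * p w.1 ≤ p ((r : 𝕜) • w.1 - w.2)
    rw [← hu, ← hu']
    exact hA r hr u p hp
  have h1 := closure_minimal hs hc hxy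
  rwa [← ofReal_smul (𝕜 := 𝕜)]

/-- The Lumer–Phillips theorem in a complete Hausdorff locally convex space. -/
theorem exists_contraction_semigroup [t : TopologicalSpace X] [T1Space X]
    [IsTopologicalAddGroup X] [ContinuousSMul 𝕜 X] (h : IsDirectedSystem t Γ)
    (hc : @CompleteSpace X (IsTopologicalAddGroup.rightUniformSpace X)) (A : X →ₗ.[𝕜] X)
    (hdense : Dense (A.domain : Set X)) (hA : IsDissipative Γ A)
    (hrange : ∃ r : ℝ, 0 < r ∧ Dense (rangeSub A r)) :
    ∃ B : X →ₗ.[𝕜] X, IsClosureOf t A B ∧ ∃ T : ℝ≥0 → X →ₗ[𝕜] X, IsSemigroup T ∧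
      IsGenerator t T B ∧ IsStronglyContinuous t T ∧ ∀ p ∈ Γ, ∀ s x, p (T s x) ≤ p x := by
  let : Module ℝ X := Module.compHom X (algebraMap ℝ 𝕜)
  have : IsScalarTower ℝ 𝕜 X := .of_algebraMap_smul fun _ _ => rfl
  have hsep := h.isSeparating
  have hseq := h.isSeqComplete hc
  set G := A.graph.topologicalClosure
  have hAG : A.graph ≤ G := A.graph.le_topologicalClosure
  have hGc : IsClosed (G : Set (X × X)) := A.graph.isClosed_topologicalClosure
  have hd := le_of_mem_closure_graph h hA
  have hdG : ∀ x, ∀ p ∈ Γ, ∀ ε : ℝ, 0 < ε → ∃ x' y', (x', y') ∈ G ∧ p (x - x') < ε := by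
    intro x p hp ε hε
    have hU : {x' | p (x - x') < ε} ∈ 𝓝 x := by
      have hcont : Continuous fun x' => p (x - x') :=
        (h.continuous hp).comp (continuous_const.sub continuous_id)
      exact (isOpen_lt hcont continuous_const).mem_nhds (by simpa using hε)
    obtain ⟨x', hx', hx'A⟩ := mem_closure_iff_nhds.1 (hdense x) _ hU
    exact ⟨x', A ⟨x', hx'A⟩, hAG (A.mem_graph ⟨x', hx'A⟩), hx'⟩
  have hmax : IsMaxDissipative Γ G := by
    refine ⟨hdG, hd, ?_⟩
    obtain ⟨r, hr, hdr⟩ := hrange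
    refine ⟨r, hr, surjective_of_dense_range h hc hGc hr (hd r hr) (hdr.mono ?_)⟩
    rintro _ ⟨x, rfl⟩
    exact ⟨x, A x, hAG (A.mem_graph x), congrArg (· - A x) (ofReal_smul (𝕜 := 𝕜) r (x : X)).symm⟩
  have hgraph : G.toLinearPMap.graph = G := by
    refine Submodule.toLinearPMap_graph_eq G ?_
    rintro ⟨x, y⟩ hxy hx
    obtain rfl : x = 0 := hx
    exact eq_zero_of_dissipative hdG hd hxy
  obtain ⟨T, hT, hTc, hT0, hTG⟩ := hmax.exists_semigroup
  refine ⟨G.toLinearPMap, ⟨⟨LinearPMap.le_of_le_graph (hgraph.symm ▸ hAG), hgraph.symm ▸ hGc⟩,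
    fun C hC => LinearPMap.le_of_le_graph ?_⟩, T, hT, fun x y => ?_,
    isStronglyContinuous_of_contraction h hT hTc hT0, hTc⟩
  · rw [hgraph]
    exact A.graph.topologicalClosure_minimal (LinearPMap.le_graph_of_le hC.1) hC.2
  · rw [hgraph, h.tendsto_iff]
    simp only [← RCLike.ofReal_inv, ofReal_smul]
    exact ⟨hTG x y, hmax.mem_of_tendsto hTc hTG⟩

end LumerPhillips

/-! ### Submixed seminorms and equitightness. -/

section Equitight

variable {𝕜 X : Type*} [RCLike 𝕜] [AddCommGroup X] [Module 𝕜 X]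

theorem exists_forall_lt_mul_le [t : TopologicalSpace X] {Γ : Set (Seminorm 𝕜 X)}
    (h : IsDirectedSystem t Γ) {p : ℕ → Seminorm 𝕜 X} (hp : ∀ n, Continuous (p n)) {a : ℕ → ℝ}
    (ha : ∀ n, 0 ≤ a n) (N : ℕ) :
    ∃ r ∈ Γ, ∃ C : ℝ, 0 ≤ C ∧ ∀ n < N, ∀ x, p n x * a n ≤ C * r x := by
  induction N with
  | zero =>
    obtain ⟨r, hr⟩ := h.nonempty
    exact ⟨r, hr, 0, le_rfl, fun n hn => absurd hn (Nat.not_lt_zero n)⟩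
  | succ N ih =>
    obtain ⟨r, hr, C, hC, hrC⟩ := ih
    obtain ⟨q, hq, D, hD, hqD⟩ := h.exists_le_of_continuous (hp N)
    obtain ⟨m, hm, E, hE, hmax⟩ := h.directed r hr q hq
    refine ⟨m, hm, C * E + D * E * a N, by have := ha N; positivity, fun n hn x => ?_⟩
    have h1 := (le_max_left _ _).trans (hmax x)
    have h2 := (le_max_right _ _).trans (hmax x)
    have h3 : 0 ≤ C * E * m x := by have := apply_nonneg m x; positivity
    have h4 : 0 ≤ D * E * a N * m x := by
      have := apply_nonneg m x
      have := ha N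
      positivity
    rcases Nat.lt_succ_iff_lt_or_eq.1 hn with hn | rfl
    · calc p n x * a n ≤ C * r x := hrC n hn x
        _ ≤ C * (E * m x) := by gcongr
        _ ≤ _ := by linarith
    · calc p n x * a n ≤ (D * (E * m x)) * a n := by
            refine mul_le_mul_of_nonneg_right ?_ (ha n)
            exact (hqD x).trans (mul_le_mul_of_nonneg_left h2 hD)
        _ ≤ _ := by linarith

/-- A submixed seminorm is dominated by a seminorm of the original topology up to a small multiple
of the norm. -/
theorem submixedSeminorms_le [t : TopologicalSpace X] {Γ Γ' : Set (Seminorm 𝕜 X)}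
    (h : IsDirectedSystem t Γ) (h' : IsDirectedSystem t Γ') {N : X → ℝ} (hN : ∀ x, 0 ≤ N x)
    (hΓ : ∀ p ∈ Γ, ∀ x, p x ≤ N x) {m : Seminorm 𝕜 X} (hm : m ∈ submixedSeminorms Γ) {ε : ℝ}
    (hε : 0 < ε) : ∃ r ∈ Γ', ∃ C : ℝ, 0 ≤ C ∧ ∀ x, m x ≤ C * r x + ε * N x := by
  obtain ⟨p, a, hp, ha, ha0, hlub⟩ := hm
  -- From `n₀` on, `a n ≤ ε` and `p n ≤ N` bound the terms by `ε * N x`; the finitely many earlier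
  -- ones are absorbed into one member of `Γ'`.
  obtain ⟨n₀, hn₀⟩ := eventually_atTop.1 (ha0.eventually_le_const hε)
  obtain ⟨r, hr, C, hC, hrC⟩ :=
    exists_forall_lt_mul_le h' (fun n => h.continuous (hp n)) ha n₀
  refine ⟨r, hr, C, hC, fun x => (hlub x).2 ?_⟩
  rintro _ ⟨n, rfl⟩
  have h1 : 0 ≤ C * r x := mul_nonneg hC (apply_nonneg _ _)
  have h2 : 0 ≤ ε * N x := mul_nonneg hε.le (hN x)
  rcases lt_or_ge n n₀ with hn | hn
  · have := hrC n hn x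
    change p n x * a n ≤ _
    linarith
  · have : p n x * a n ≤ N x * ε :=
      mul_le_mul (hΓ _ (hp n) x) (hn₀ n hn) (ha n) (hN x)
    change p n x * a n ≤ _
    linarith

/-- The supremum is a maximum and not a sum, so `ε` does not grow with the number of seminorms. -/
theorem finset_sup_submixedSeminorms_le [t : TopologicalSpace X] {Γ Γ' : Set (Seminorm 𝕜 X)}
    (h : IsDirectedSystem t Γ) (h' : IsDirectedSystem t Γ') {N : X → ℝ} (hN : ∀ x, 0 ≤ N x)
    (hΓ : ∀ p ∈ Γ, ∀ x, p x ≤ N x) {ε : ℝ} (hε : 0 < ε) (s : Finset (submixedSeminorms Γ)) :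
    ∃ r ∈ Γ', ∃ C : ℝ, 0 ≤ C ∧
      ∀ x, s.sup (fun p : submixedSeminorms Γ => (p : Seminorm 𝕜 X)) x ≤ C * r x + ε * N x := by
  classical
  induction s using Finset.induction_on with
  | empty =>
    obtain ⟨r, hr⟩ := h'.nonempty
    refine ⟨r, hr, 0, le_rfl, fun x => ?_⟩
    simpa using mul_nonneg hε.le (hN x)
  | insert m s _ ih =>
    obtain ⟨r, hr, C, hC, hs⟩ := ih
    obtain ⟨q, hq, D, hD, hmq⟩ := submixedSeminorms_le h h' hN hΓ m.2 hε
    obtain ⟨k, hk, E, hE, hmax⟩ := h'.directed r hr q hq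
    refine ⟨k, hk, C * E + D * E, by positivity, fun x => ?_⟩
    rw [Finset.sup_insert, Seminorm.sup_apply]
    have h1 := mul_le_mul_of_nonneg_left ((le_max_left _ _).trans (hmax x)) hC
    have h2 := mul_le_mul_of_nonneg_left ((le_max_right _ _).trans (hmax x)) hD
    have h3 : 0 ≤ C * (E * k x) := by have := apply_nonneg k x; positivity
    have h4 : 0 ≤ D * (E * k x) := by have := apply_nonneg k x; positivity
    have h5 := hmq x
    have h6 := hs x
    refine max_le ?_ ?_ <;> linarith

end Equitight

section Equitight

variable {𝕜 X : Type*} [RCLike 𝕜] [NormedAddCommGroup X] [NormedSpace 𝕜 X]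

/-- Two systems for `τ` play different roles: the norming `Γτ` controls the tails by the norm, while
`Γτ'` is the system in which the conclusion is tested. -/
theorem IsEquicontinuous.isEquitight {τ γ : TopologicalSpace X} (hle : γ ≤ τ)
    {Γ Γτ Γτ' : Set (Seminorm 𝕜 X)} (hΓ : IsDirectedSystem γ Γ) (hΓτ : IsDirectedSystem τ Γτ)
    (hnorm : IsNorming Γτ) (hγ : γ = submixedTopology Γτ) (hΓτ' : IsDirectedSystem τ Γτ')
    {T : ℝ≥0 → X →ₗ[𝕜] X} (hT : IsEquicontinuous Γ T) : IsEquitight Γτ' T := by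
  intro ε hε p hp
  have hpγ : @Continuous X ℝ γ _ p :=
    continuous_le_dom hle (@IsDirectedSystem.continuous _ _ _ _ _ _ τ hΓτ' _ hp)
  obtain ⟨q, hq, C, hC, hpq⟩ :=
    @IsDirectedSystem.exists_le_of_continuous _ _ _ _ _ _ γ hΓ _ hpγ
  obtain ⟨q', hq', D, hD, hqq'⟩ := hT q hq
  have hw : @WithSeminorms 𝕜 X (submixedSeminorms Γτ) _ _ _
      (fun p : submixedSeminorms Γτ => (p : Seminorm 𝕜 X)) γ := by
    let := γ
    exact ⟨hγ⟩
  obtain ⟨s, E, -, hs⟩ := @Seminorm.bound_of_continuous 𝕜 X (submixedSeminorms Γτ) _ _ _ _ γ hw q'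
    (@IsDirectedSystem.continuous _ _ _ _ _ _ γ hΓ _ hq')
  set M : ℝ := C * (D * E)
  have hM : 0 ≤ M := by positivity
  obtain ⟨r, hr, F, hF, hsr⟩ := @finset_sup_submixedSeminorms_le 𝕜 X _ _ _ τ Γτ Γτ' hΓτ hΓτ'
    (fun x => ‖x‖) (fun x => norm_nonneg x) (fun p hp x => (hnorm x).1 ⟨p, hp, rfl⟩)
    -- The later multiplication by `M` must leave at most `ε`; adding one covers `M = 0`.
    (ε / (M + 1)) (by positivity) s
  refine ⟨r, hr, M * F, by positivity, fun u x => ?_⟩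
  calc p (T u x) ≤ C * q (T u x) := hpq _
    _ ≤ C * (D * q' x) := by gcongr; exact hqq' u x
    _ ≤ C * (D * (E * s.sup (fun p : submixedSeminorms Γτ => (p : Seminorm 𝕜 X)) x)) := by
        gcongr
        exact hs x
    _ = M * s.sup (fun p : submixedSeminorms Γτ => (p : Seminorm 𝕜 X)) x := by ring
    _ ≤ M * (F * r x + ε / (M + 1) * ‖x‖) := by gcongr; exact hsr x
    _ = M * F * r x + (M / (M + 1)) * (ε * ‖x‖) := by ring
    _ ≤ M * F * r x + 1 * (ε * ‖x‖) := by
        gcongr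
        exact div_le_one_of_le₀ (by linarith) (by linarith)
    _ = _ := by rw [one_mul]

end Equitight

end Saks

/-! ### Application to the mixed topology. -/

theorem mainTheorem2 {𝕜 X : Type*} [RCLike 𝕜] [NormedAddCommGroup X] [NormedSpace 𝕜 X]
    [CompleteSpace X] (τ : TopologicalSpace X) (hX : Saks.IsCompleteSaksSpace 𝕜 τ)
    (Γ : Set (Seminorm 𝕜 X)) (hΓ : Saks.IsDirectedSystem (Saks.mixedTopology 𝕜 τ) Γ)
    (A : X →ₗ.[𝕜] X)
    (hA_dense : @Dense X (Saks.mixedTopology 𝕜 τ) (A.domain : Set X))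
    (hA_diss : Saks.IsDissipative Γ A)
    (hA_range : ∃ r : ℝ, 0 < r ∧ @Dense X (Saks.mixedTopology 𝕜 τ) (Saks.rangeSub A r)) :
    ∃ Abar : X →ₗ.[𝕜] X, Saks.IsClosureOf (Saks.mixedTopology 𝕜 τ) A Abar ∧
    ∃ T : ℝ≥0 → X →ₗ[𝕜] X,
      Saks.IsSemigroup T ∧
      Saks.IsGenerator (Saks.mixedTopology 𝕜 τ) T Abar ∧
      Saks.IsStronglyContinuous (Saks.mixedTopology 𝕜 τ) T ∧
      Saks.IsEquicontinuous Γ T ∧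
      (Saks.IsNorming Γ → Saks.IsContractive T) ∧
      (Saks.IsNorming Γ →
        (∃ Γτ : Set (Seminorm 𝕜 X), Saks.IsDirectedSystem τ Γτ ∧ Saks.IsNorming Γτ ∧
          Saks.mixedTopology 𝕜 τ = Saks.submixedTopology Γτ) →
        ∀ Γτ' : Set (Seminorm 𝕜 X), Saks.IsDirectedSystem τ Γτ' → Saks.IsEquitight Γτ' T) := by
  obtain ⟨Γ₀, hΓ₀, -⟩ := hX.exists_norming
  have hw := @Saks.IsDirectedSystem.withSeminorms 𝕜 X _ _ _ Γ₀ τ hΓ₀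
  have hle : Saks.mixedTopology 𝕜 τ ≤ τ :=
    (Saks.isLeast_mixedTopology 𝕜 τ (@WithSeminorms.topologicalAddGroup _ _ _ _ _ _ τ _ hw)
      (@WithSeminorms.continuousSMul _ _ _ _ _ _ τ _ hw) hX.coarser).1.2.2.2.1
  have hwγ := @Saks.IsDirectedSystem.withSeminorms 𝕜 X _ _ _ Γ (Saks.mixedTopology 𝕜 τ) hΓ
  have hsmul := @WithSeminorms.continuousSMul _ _ _ _ _ _ (Saks.mixedTopology 𝕜 τ) _ hwγ
  -- The mixed topology is finer than the Hausdorff topology `τ`.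
  have ht1 : @T1Space X (Saks.mixedTopology 𝕜 τ) :=
    @T2Space.t1Space X (Saks.mixedTopology 𝕜 τ) (@T2Space.of_injective_continuous X X
      (Saks.mixedTopology 𝕜 τ) τ hX.t2 id Function.injective_id (continuous_id_iff_le.2 hle))
  obtain ⟨B, hB, T, hT, hgen, hcont, hp⟩ :=
    @Saks.exists_contraction_semigroup 𝕜 X _ _ _ Γ (Saks.mixedTopology 𝕜 τ) ht1
      (Saks.mixedTopology_isTopologicalAddGroup 𝕜 τ) hsmul hΓ hX.complete A hA_dense hA_diss
      hA_range
  have hequi : Saks.IsEquicontinuous Γ T := fun p hpΓ =>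
    ⟨p, hpΓ, 1, zero_le_one, fun s x => by rw [one_mul]; exact hp p hpΓ s x⟩
  refine ⟨B, hB, T, hT, hgen, hcont, hequi, fun hn s x => (hn (T s x)).2 ?_, ?_⟩
  · rintro _ ⟨p, hpΓ, rfl⟩
    exact (hp p hpΓ s x).trans ((hn x).1 ⟨p, hpΓ, rfl⟩)
  · rintro - ⟨Γτ, hΓτ, hnorm, hγ⟩ Γτ' hΓτ'
    exact hequi.isEquitight hle hΓ hΓτ hnorm hγ hΓτ'
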